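/- For a positive integer $n$, let $\sigma(n)=\sum_{d\mid n}d$ denote the sum of the positive divisors of $n$. Suppose that there is no positive integer $m$ such that $m\mid\sigma(m)$ and $(m+1)\mid\sigma(m+1)$. Then there is an absolute constant $C>0$ such that for every real number $x\ge e^{e}$, the number of positive integers $n\le x$ with $\sigma(n)=\sigma(n+1)$ is at most $$C\,x\exp\left(-2^{-1/2}(\log x\,\log\log\log x)^{1/2}\right).$$ -/

import Mathlib

open Finset

/-- The partial sums of the harmonic series, as real numbers. -/
noncomputable def harmonicSum (Y : ℕ) : ℝ := ∑ j ∈ Icc 1 Y, (j : ℝ)⁻¹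

theorem harmonicSum_le_one_add_log (Y : ℕ) : harmonicSum Y ≤ 1 + Real.log Y := by
  have h := harmonic_le_one_add_log Y
  rw [harmonic_eq_sum_Icc] at h
  push_cast at h
  exact h

theorem one_le_harmonicSum {Y : ℕ} (hY : 1 ≤ Y) : 1 ≤ harmonicSum Y := by
  have := single_le_sum (f := fun j : ℕ => (j : ℝ)⁻¹) (s := Icc 1 Y) (fun i _ => by positivity)
    (mem_Icc.2 ⟨le_rfl, hY⟩)
  simpa [harmonicSum] using this

theorem harmonicSum_mono {X Y : ℕ} (h : X ≤ Y) : harmonicSum X ≤ harmonicSum Y :=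
  sum_le_sum_of_subset_of_nonneg (Icc_subset_Icc_right h) fun _ _ _ => by positivity

theorem card_le_sum_of_forall_exists {α ι : Type*} {S : Finset α} (I : Finset ι)
    (F : ι → Finset α) (B : ι → ℝ) (hB : ∀ i ∈ I, ((F i).card : ℝ) ≤ B i)
    (h : ∀ n ∈ S, ∃ i ∈ I, n ∈ F i) : (S.card : ℝ) ≤ ∑ i ∈ I, B i := by
  classical
  have h1 : S ⊆ I.biUnion F := fun n hn => by
    obtain ⟨i, hi, hni⟩ := h n hn
    exact mem_biUnion.2 ⟨i, hi, hni⟩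
  calc (S.card : ℝ) ≤ ((I.biUnion F).card : ℝ) := by exact_mod_cast card_le_card h1
    _ ≤ ((∑ i ∈ I, (F i).card : ℕ) : ℝ) := by exact_mod_cast card_biUnion_le
    _ = ∑ i ∈ I, ((F i).card : ℝ) := by push_cast; rfl
    _ ≤ _ := sum_le_sum hB

/-- A set in which any two elements are congruent modulo `m` has few elements up to `N`. -/
theorem card_le_of_pairwise_modEq {S : Finset ℕ} {N m : ℕ} (hS : ∀ n ∈ S, n ≤ N)
    (h : ∀ n ∈ S, ∀ n' ∈ S, n ≡ n' [MOD m]) : (S.card : ℝ) ≤ N / m + 1 := by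
  have h1 : S.card ≤ (range (N / m + 1)).card := by
    refine card_le_card_of_injOn (fun n => n / m) (fun n hn => ?_) (fun n hn n' hn' e => ?_)
    · simp only [coe_range, Set.mem_Iio]
      exact Nat.lt_succ_of_le (Nat.div_le_div_right (hS n hn))
    · have h2 := h n hn n' hn'
      rw [← Nat.div_add_mod n m, ← Nat.div_add_mod n' m]
      simp only at e
      rw [e, h2]
  rw [card_range] at h1
  have h2 : ((N / m : ℕ) : ℝ) ≤ (N : ℝ) / m := Nat.cast_div_le
  have h3 : (S.card : ℝ) ≤ ((N / m + 1 : ℕ) : ℝ) := by exact_mod_cast h1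
  push_cast at h3
  linarith

/-- Integers up to `N` with prescribed coprime divisors of `n + i` and `n + j`. -/
theorem card_filter_dvd_add_dvd_add_le (N i j A B : ℕ)
    (hAB : A.Coprime B) :
    (((Icc 1 N).filter fun n => A ∣ n + i ∧ B ∣ n + j).card : ℝ) ≤ N / (A * B) + 1 := by
  have := card_le_of_pairwise_modEq (S := (Icc 1 N).filter fun n => A ∣ n + i ∧ B ∣ n + j)
    (N := N) (m := A * B) (fun n hn => (mem_Icc.1 (mem_filter.1 hn).1).2) ?_
  · simpa using this
  · intro n hn n' hn'
    simp only [mem_filter] at hn hn'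
    refine (Nat.modEq_and_modEq_iff_modEq_mul hAB).1 ⟨?_, ?_⟩
    · refine Nat.ModEq.add_right_cancel' i ?_
      exact ((Nat.modEq_zero_iff_dvd.2 hn.2.1)).trans (Nat.modEq_zero_iff_dvd.2 hn'.2.1).symm
    · refine Nat.ModEq.add_right_cancel' j ?_
      exact ((Nat.modEq_zero_iff_dvd.2 hn.2.2)).trans (Nat.modEq_zero_iff_dvd.2 hn'.2.2).symm

theorem card_filter_dvd_add_le (N i m : ℕ) (hi : i ≤ 1) (hm : 0 < m) :
    (((Icc 1 N).filter fun n => m ∣ n + i).card : ℝ) ≤ (N + 1) / m := by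
  have h1 : ((Icc 1 N).filter fun n => m ∣ n + i).card ≤ (Icc 1 ((N + 1) / m)).card := by
    refine card_le_card_of_injOn (fun n => (n + i) / m) (fun n hn => ?_) (fun n hn n' hn' e => ?_)
    · simp only [coe_filter, mem_Icc, Set.mem_ofPred_eq] at hn
      simp only [coe_Icc, Set.mem_Icc]
      refine ⟨Nat.div_pos (Nat.le_of_dvd (by omega) hn.2) hm, Nat.div_le_div_right (by omega)⟩
    · simp only [coe_filter, mem_Icc, Set.mem_ofPred_eq] at hn hn'
      have := (Nat.div_left_inj hn.2 hn'.2).1 e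
      omega
  have h2 : (((N + 1) / m : ℕ) : ℝ) ≤ ((N + 1 : ℕ) : ℝ) / m := Nat.cast_div_le
  rw [Nat.card_Icc, Nat.add_sub_cancel] at h1
  push_cast at h2
  exact le_trans (by exact_mod_cast h1) h2

/-- Reciprocals of integers `p` with `p ≡ -1` modulo `g`. -/
theorem sum_inv_filter_dvd_succ_le (X g : ℕ) (hg : 0 < g) :
    ∑ p ∈ (Icc 1 X).filter (fun p => g ∣ p + 1), (p : ℝ)⁻¹ ≤ 2 * harmonicSum (X + 1) / g := by
  have hg' : (0 : ℝ) < g := by exact_mod_cast hg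
  have h1 : ∀ p ∈ (Icc 1 X).filter (fun p => g ∣ p + 1),
      (p : ℝ)⁻¹ ≤ 2 / g * (((p + 1) / g : ℕ) : ℝ)⁻¹ := by
    intro p hp
    simp only [mem_filter, mem_Icc] at hp
    rw [Nat.cast_div hp.2 hg'.ne']
    have hp1 : (1 : ℝ) ≤ p := by exact_mod_cast hp.1.1
    push_cast
    rw [inv_div, div_mul_div_comm, mul_comm (g : ℝ), mul_div_mul_right _ _ hg'.ne', inv_eq_one_div,
      div_le_div_iff₀ (by linarith) (by linarith)]
    linarith
  refine (sum_le_sum h1).trans ?_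
  rw [← mul_sum, mul_div_right_comm]
  refine mul_le_mul_of_nonneg_left ?_ (by positivity)
  have hinj : Set.InjOn (fun p => (p + 1) / g) ((Icc 1 X).filter (fun p => g ∣ p + 1) : Finset ℕ) := by
    intro p hp p' hp' e
    simp only [coe_filter, mem_Icc, Set.mem_ofPred_eq] at hp hp'
    have := (Nat.div_left_inj hp.2 hp'.2).1 e
    omega
  rw [← sum_image (f := fun j : ℕ => (j : ℝ)⁻¹) hinj, harmonicSum]
  refine sum_le_sum_of_subset_of_nonneg (fun j hj => ?_) fun _ _ _ => by positivity
  obtain ⟨p, hp, rfl⟩ := mem_image.1 hj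
  simp only [mem_filter, mem_Icc] at hp ⊢
  exact ⟨Nat.div_pos (Nat.le_of_dvd (by omega) hp.2) hg,
    (Nat.div_le_self _ _).trans (by omega)⟩

/-- Pairs of positive integers with product at most `M`. -/
theorem card_filter_mul_le (Y : ℕ) (M : ℝ) (hM : 0 ≤ M) :
    (((Icc 1 Y ×ˢ Icc 1 Y).filter fun c : ℕ × ℕ => (c.1 * c.2 : ℝ) ≤ M).card : ℝ) ≤
      M * harmonicSum Y := by
  rw [harmonicSum, mul_sum]
  refine card_le_sum_of_forall_exists (Icc 1 Y)
    (fun a => (Icc 1 ⌊M / a⌋₊).map ⟨fun b => (a, b), fun b b' h => (Prod.mk.inj h).2⟩) _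
    (fun a _ => ?_) (fun c hc => ?_)
  · rw [card_map, Nat.card_Icc, Nat.add_sub_cancel, ← div_eq_mul_inv]
    exact Nat.floor_le (by positivity)
  · simp only [mem_filter, mem_product, mem_Icc] at hc
    refine ⟨c.1, mem_Icc.2 hc.1.1, mem_map.2 ⟨c.2, mem_Icc.2 ⟨hc.1.2.1, Nat.le_floor ?_⟩, rfl⟩⟩
    have : (0 : ℝ) < c.1 := by exact_mod_cast hc.1.1.1
    rw [le_div_iff₀ this, mul_comm]
    exact hc.2

/-- A crude bound for the sum of the reciprocals of the primes. -/
theorem sum_inv_primesBelow_sq_le (W : ℕ) :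
    (∑ p ∈ W.primesBelow, (p : ℝ)⁻¹) ^ 2 ≤ 2 * harmonicSum (W ^ 2) := by
  set P := W.primesBelow
  have hP : ∀ p ∈ P, p.Prime ∧ p < W := fun p hp =>
    ⟨Nat.prime_of_mem_primesBelow hp, Nat.lt_of_mem_primesBelow hp⟩
  have key : ∑ c ∈ (P ×ˢ P).filter (fun c => c.1 ≤ c.2), ((c.1 : ℝ)⁻¹ * (c.2 : ℝ)⁻¹) ≤
      harmonicSum (W ^ 2) := by
    have hinj : Set.InjOn (fun c : ℕ × ℕ => c.1 * c.2)
        ((P ×ˢ P).filter (fun c => c.1 ≤ c.2) : Finset (ℕ × ℕ)) := by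
      have hmin : ∀ c ∈ (P ×ˢ P).filter (fun c => c.1 ≤ c.2), (c.1 * c.2).minFac = c.1 := by
        intro c hc
        simp only [mem_filter, mem_product] at hc
        have h1 := (hP _ hc.1.1).1
        have h2 := (hP _ hc.1.2).1
        refine le_antisymm (Nat.minFac_le_of_dvd h1.two_le (dvd_mul_right _ _)) ?_
        have h3 : (c.1 * c.2).minFac.Prime :=
          Nat.minFac_prime fun h => h1.ne_one (Nat.eq_one_of_mul_eq_one_right h)
        rcases h3.dvd_mul.1 (Nat.minFac_dvd _) with h | h
        · exact ((Nat.prime_dvd_prime_iff_eq h3 h1).1 h).ge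
        · rw [(Nat.prime_dvd_prime_iff_eq h3 h2).1 h]
          exact hc.2
      intro c hc c' hc' e
      have h1 : c.1 = c'.1 := by
        rw [← hmin c hc, ← hmin c' hc']
        exact congrArg Nat.minFac e
      refine Prod.ext h1 ?_
      have hc1 := (hP c.1 (mem_product.1 (mem_filter.1 hc).1).1).1.pos
      simp only [← h1] at e
      exact Nat.eq_of_mul_eq_mul_left hc1 e
    calc _ = ∑ c ∈ (P ×ˢ P).filter (fun c => c.1 ≤ c.2), (((c.1 * c.2 : ℕ) : ℝ))⁻¹ :=
          sum_congr rfl fun c _ => by push_cast; rw [mul_inv]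
      _ = ∑ j ∈ ((P ×ˢ P).filter (fun c => c.1 ≤ c.2)).image (fun c : ℕ × ℕ => c.1 * c.2),
          (j : ℝ)⁻¹ :=
          (sum_image (f := fun j : ℕ => (j : ℝ)⁻¹) hinj).symm
      _ ≤ _ := by
        refine sum_le_sum_of_subset_of_nonneg (fun j hj => ?_) fun _ _ _ => by positivity
        obtain ⟨c, hc, rfl⟩ := mem_image.1 hj
        simp only [mem_filter, mem_product] at hc
        have h1 := hP _ hc.1.1
        have h2 := hP _ hc.1.2
        refine mem_Icc.2 ⟨Nat.mul_pos h1.1.pos h2.1.pos, ?_⟩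
        rw [sq]
        exact Nat.mul_le_mul h1.2.le h2.2.le
  have key2 : ∑ c ∈ (P ×ˢ P).filter (fun c => ¬ c.1 ≤ c.2), ((c.1 : ℝ)⁻¹ * (c.2 : ℝ)⁻¹) ≤
      harmonicSum (W ^ 2) := by
    refine le_trans ?_ key
    have h1 : ∑ c ∈ (P ×ˢ P).filter (fun c => ¬ c.1 ≤ c.2), ((c.1 : ℝ)⁻¹ * (c.2 : ℝ)⁻¹) =
        ∑ c ∈ ((P ×ˢ P).filter (fun c => ¬ c.1 ≤ c.2)).map (Equiv.prodComm ℕ ℕ).toEmbedding,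
          ((c.1 : ℝ)⁻¹ * (c.2 : ℝ)⁻¹) := by
      rw [sum_map]
      exact sum_congr rfl fun c _ => mul_comm _ _
    rw [h1]
    refine sum_le_sum_of_subset_of_nonneg (fun c hc => ?_) fun _ _ _ => by positivity
    simp only [mem_map_equiv, Equiv.prodComm_symm, Equiv.prodComm_apply, mem_filter, mem_product,
      Prod.fst_swap, Prod.snd_swap] at hc ⊢
    exact ⟨⟨hc.1.2, hc.1.1⟩, by omega⟩
  rw [sq, sum_mul_sum, ← sum_product', ← sum_filter_add_sum_filter_not _ (fun c => c.1 ≤ c.2)]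
  linarith

/-- The sum of the reciprocals of the `W`-smooth numbers in `(z, Y]`. -/
noncomputable def smoothTail (Y W : ℕ) (z : ℝ) : ℝ := by
  classical
  exact ∑ s ∈ (Icc 1 Y).filter (fun s => s ∈ W.smoothNumbers ∧ z < s), (s : ℝ)⁻¹

theorem smoothTail_nonneg (Y W : ℕ) (z : ℝ) : 0 ≤ smoothTail Y W z :=
  sum_nonneg fun _ _ => by positivity

/-- Rankin's bound. -/
theorem smoothTail_le (Y W : ℕ) {z δ : ℝ} (hz : 0 < z) (hδ : 0 < δ) (hδ' : δ ≤ 1 / 4) :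
    smoothTail Y W z ≤
      z ^ (-δ) * Real.exp (3 * (W : ℝ) ^ δ * ∑ p ∈ W.primesBelow, (p : ℝ)⁻¹) := by
  classical
  let f : ℕ →* ℝ :=
    { toFun := fun n => (n : ℝ) ^ (δ - 1)
      map_one' := by simp
      map_mul' := fun a b => by
        push_cast
        exact Real.mul_rpow (by positivity) (by positivity) }
  have hf : ∀ n, f n = (n : ℝ) ^ (δ - 1) := fun _ => rfl
  have hfn : ∀ n, 0 ≤ f n := fun n => by rw [hf]; positivity
  have hp34 : ∀ p : ℕ, p.Prime → f p ≤ 2 / 3 := by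
    intro p hp
    have h2 : (2 : ℝ) ≤ p := by exact_mod_cast hp.two_le
    calc f p ≤ (2 : ℝ) ^ (δ - 1) :=
          Real.rpow_le_rpow_of_nonpos (by norm_num) h2 (by linarith)
      _ ≤ (2 : ℝ) ^ (-(3 / 4) : ℝ) := Real.rpow_le_rpow_of_exponent_le (by norm_num) (by linarith)
      _ ≤ 2 / 3 := by
        rw [← pow_le_pow_iff_left₀ (by positivity) (by norm_num) (by norm_num : 4 ≠ 0),
          ← Real.rpow_natCast, ← Real.rpow_mul (by norm_num)]
        norm_num [Real.rpow_neg]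
  obtain ⟨h1, h2⟩ := EulerProduct.summable_and_hasSum_smoothNumbers_prod_primesBelow_geometric
    (f := f) (fun {p} hp => by
      rw [Real.norm_of_nonneg (hfn p)]
      linarith [hp34 p hp]) W
  have hprod : ∏ p ∈ W.primesBelow, (1 - f p)⁻¹ ≤
      Real.exp (3 * (W : ℝ) ^ δ * ∑ p ∈ W.primesBelow, (p : ℝ)⁻¹) := by
    rw [mul_sum, Real.exp_sum]
    refine prod_le_prod (fun p hp => ?_) (fun p hp => ?_)
    · have := hp34 p (Nat.prime_of_mem_primesBelow hp)
      exact inv_nonneg.2 (by linarith)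
    · have hpr := Nat.prime_of_mem_primesBelow hp
      have h3 := hp34 p hpr
      have hp0 : (0 : ℝ) < p := by exact_mod_cast hpr.pos
      have h4 : f p ≤ (W : ℝ) ^ δ * (p : ℝ)⁻¹ := by
        rw [hf, Real.rpow_sub_one hp0.ne', div_eq_mul_inv]
        gcongr
        exact (Nat.lt_of_mem_primesBelow hp).le
      calc (1 - f p)⁻¹ ≤ 3 * f p + 1 := by
            rw [inv_le_iff_one_le_mul₀ (by linarith)]
            nlinarith [hfn p]
        _ ≤ 3 * (W : ℝ) ^ δ * (p : ℝ)⁻¹ + 1 := by linarith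
        _ ≤ _ := Real.add_one_le_exp _
  have hsum : ∑ s ∈ (Icc 1 Y).filter (fun s => s ∈ W.smoothNumbers ∧ z < s), f s ≤
      ∏ p ∈ W.primesBelow, (1 - f p)⁻¹ := by
    have h3 := sum_le_hasSum (((Icc 1 Y).filter (fun s => s ∈ W.smoothNumbers ∧ z < s)).subtype
      (· ∈ W.smoothNumbers)) (fun i _ => hfn i) h2
    rw [sum_subtype_eq_sum_filter, filter_true_of_mem
      (fun s hs => (mem_filter.1 hs).2.1)] at h3
    exact h3
  calc smoothTail Y W z
      ≤ ∑ s ∈ (Icc 1 Y).filter (fun s => s ∈ W.smoothNumbers ∧ z < s), z ^ (-δ) * f s := by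
        refine sum_le_sum fun s hs => ?_
        simp only [mem_filter, mem_Icc] at hs
        have hs0 : (0 : ℝ) < s := by exact_mod_cast hs.1.1
        have : (s : ℝ)⁻¹ = (s : ℝ) ^ (-δ) * f s := by
          rw [hf, ← Real.rpow_add hs0, ← Real.rpow_neg_one]
          congr 1
          ring
        rw [this]
        exact mul_le_mul_of_nonneg_right
          (Real.rpow_le_rpow_of_nonpos hz hs.2.2.le (by linarith)) (hfn s)
    _ = z ^ (-δ) * ∑ s ∈ (Icc 1 Y).filter (fun s => s ∈ W.smoothNumbers ∧ z < s), f s := by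
        rw [mul_sum]
    _ ≤ _ := mul_le_mul_of_nonneg_left (hsum.trans hprod) (by positivity)

theorem exists_smooth_mul_rough (w : ℕ) {n : ℕ} (hn : n ≠ 0) :
    ∃ s d, n = s * d ∧ s ∈ w.smoothNumbers ∧ ∀ p, p.Prime → p ∣ d → w ≤ p := by
  induction n using induction_on_primes with
  | zero => exact absurd rfl hn
  | one => exact ⟨1, 1, rfl, ⟨one_ne_zero, by simp⟩, fun p hp h => absurd h hp.not_dvd_one⟩
  | prime_mul p a hp ih =>
    obtain ⟨s, d, rfl, hs, hd⟩ := ih (by rintro rfl; simp at hn)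
    by_cases hpw : p < w
    · refine ⟨p * s, d, by ring, Nat.mul_mem_smoothNumbers ?_ hs, hd⟩
      exact Nat.mem_smoothNumbers_of_lt hp.pos hpw
    · refine ⟨s, p * d, by ring, hs, fun q hq hqd => ?_⟩
      rcases (hq.dvd_mul).1 hqd with h | h
      · rw [(Nat.prime_dvd_prime_iff_eq hq hp).1 h]
        omega
      · exact hd q hq h

/-- Integers up to `X` that are smooth. -/
theorem card_filter_smooth_le (X W : ℕ) {Z : ℝ} (hZ : 0 ≤ Z) :
    (((Icc 1 X).filter (· ∈ W.smoothNumbers)).card : ℝ) ≤ Z + X * smoothTail X W Z := by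
  classical
  have h1 : (Icc 1 X).filter (· ∈ W.smoothNumbers) ⊆ Icc 1 ⌊Z⌋₊ ∪
      (Icc 1 X).filter (fun s => s ∈ W.smoothNumbers ∧ Z < s) := by
    intro s hs
    simp only [mem_union, mem_filter, mem_Icc] at hs ⊢
    rcases le_or_gt (s : ℝ) Z with h | h
    · exact Or.inl ⟨hs.1.1, Nat.le_floor h⟩
    · exact Or.inr ⟨hs.1, hs.2, h⟩
  have h2 : (((Icc 1 X).filter (· ∈ W.smoothNumbers)).card : ℝ) ≤ (Icc 1 ⌊Z⌋₊).card +
      ((Icc 1 X).filter (fun s => s ∈ W.smoothNumbers ∧ Z < s)).card := by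
    exact_mod_cast (card_le_card h1).trans (card_union_le _ _)
  refine h2.trans (add_le_add ?_ ?_)
  · rw [Nat.card_Icc, Nat.add_sub_cancel]
    exact Nat.floor_le hZ
  · rw [smoothTail, mul_sum, ← nsmul_one, ← sum_const]
    refine sum_le_sum fun s hs => ?_
    simp only [mem_filter, mem_Icc] at hs
    have hs0 : (0 : ℝ) < s := by exact_mod_cast hs.1.1
    rw [← div_eq_mul_inv, le_div_iff₀ hs0, one_mul]
    exact_mod_cast hs.1.2

theorem sum_le_sum_comp_of_cover {ι : Type*} {S : Finset ℕ} (I : Finset ι) (φ : ι → ℕ)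
    (f : ℕ → ℝ) (hf : ∀ n, 0 ≤ f n) (h : ∀ n ∈ S, ∃ i ∈ I, φ i = n) :
    ∑ n ∈ S, f n ≤ ∑ i ∈ I, f (φ i) := by
  classical
  rcases S.eq_empty_or_nonempty with rfl | ⟨n₀, hn₀⟩
  · simpa using sum_nonneg fun i _ => hf (φ i)
  have : Nonempty ι := ⟨(h n₀ hn₀).choose⟩
  choose! ψ hψ hψ' using h
  have hinj : Set.InjOn ψ (S : Set ℕ) := fun a ha b hb e => by
    rw [← hψ' a ha, ← hψ' b hb, e]
  calc ∑ n ∈ S, f n = ∑ n ∈ S, f (φ (ψ n)) := sum_congr rfl fun n hn => by rw [hψ' n hn]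
    _ = ∑ i ∈ S.image ψ, f (φ i) := (sum_image (f := fun i => f (φ i)) hinj).symm
    _ ≤ _ := by
      refine sum_le_sum_of_subset_of_nonneg (fun i hi => ?_) fun _ _ _ => hf _
      obtain ⟨n, hn, rfl⟩ := mem_image.1 hi
      exact hψ n hn

open ArithmeticFunction

theorem sigma_one_prime_pow_lt {q : ℕ} (hq : q.Prime) (e : ℕ) : sigma 1 (q ^ e) < 2 * q ^ e := by
  rw [sigma_one_apply_prime_pow hq]
  induction e with
  | zero => simp
  | succ e ih =>
    rw [sum_range_succ, pow_succ]
    have := Nat.mul_le_mul_left (q ^ e) hq.two_le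
    omega

/-- Reciprocals of the prime powers `Q ≤ Y` for which `g` divides `σ(Q)`. -/
theorem sum_inv_primePow_dvd_sigma_le (Y g : ℕ) (hg : 0 < g) :
    ∑ Q ∈ (Icc 1 Y).filter (fun Q => IsPrimePow Q ∧ g ∣ sigma 1 Q), (Q : ℝ)⁻¹ ≤
      2 * harmonicSum (Y + 1) * (1 + Nat.log 2 Y) * ((g : ℝ) ^ (-(1 / 4) : ℝ)) ^ 2 := by
  have hg1 : (1 : ℝ) ≤ g := by exact_mod_cast hg
  have hg0 : (0 : ℝ) < g := by linarith
  have hsq : ((g : ℝ) ^ (-(1 / 4) : ℝ)) ^ 2 = (g : ℝ) ^ (-(1 / 2) : ℝ) := by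
    rw [← Real.rpow_natCast, ← Real.rpow_mul hg0.le]
    norm_num
  rw [hsq]
  have hH : 0 ≤ harmonicSum (Y + 1) := zero_le_one.trans (one_le_harmonicSum (by omega))
  classical
  set A := (Icc 1 Y).filter (fun Q => IsPrimePow Q ∧ g ∣ sigma 1 Q)
  rw [← sum_filter_add_sum_filter_not A Nat.Prime]
  have h1 : ∑ Q ∈ A.filter Nat.Prime, (Q : ℝ)⁻¹ ≤
      2 * harmonicSum (Y + 1) * (g : ℝ) ^ (-(1 / 2) : ℝ) := by
    calc _ ≤ ∑ p ∈ (Icc 1 Y).filter (fun p => g ∣ p + 1), (p : ℝ)⁻¹ := by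
          refine sum_le_sum_of_subset_of_nonneg (fun p hp => ?_) fun _ _ _ => by positivity
          simp only [A, mem_filter] at hp ⊢
          refine ⟨hp.1.1, ?_⟩
          have := hp.1.2.2
          rwa [← pow_one p, sigma_one_apply_prime_pow hp.2, sum_range_succ, sum_range_one,
            pow_zero, pow_one, add_comm] at this
      _ ≤ _ := sum_inv_filter_dvd_succ_le Y g hg
      _ ≤ _ := by
        rw [div_eq_mul_inv, ← Real.rpow_neg_one]
        exact mul_le_mul_of_nonneg_left
          (Real.rpow_le_rpow_of_exponent_le hg1 (by norm_num)) (by positivity)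
  have h2 : ∑ Q ∈ A.filter (fun Q => ¬ Q.Prime), (Q : ℝ)⁻¹ ≤
      2 * harmonicSum (Y + 1) * Nat.log 2 Y * (g : ℝ) ^ (-(1 / 2) : ℝ) := by
    have h3 : ∀ Q ∈ A.filter (fun Q => ¬ Q.Prime),
        (Q : ℝ)⁻¹ ≤ 2 * (g : ℝ) ^ (-(1 / 2) : ℝ) * (Q : ℝ) ^ (-(1 / 2) : ℝ) := by
      intro Q hQ
      simp only [A, mem_filter, mem_Icc] at hQ
      have hQ1 : (1 : ℝ) ≤ Q := by exact_mod_cast hQ.1.1.1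
      have hgQ : (g : ℝ) ≤ 2 * Q := by
        obtain ⟨q, e, hq, he, rfl⟩ := (isPrimePow_nat_iff Q).1 hQ.1.2.1
        have h4 := Nat.le_of_dvd (sigma_pos 1 _ (pow_pos hq.pos e).ne') hQ.1.2.2
        have h5 := sigma_one_prime_pow_lt hq e
        exact_mod_cast (h4.trans h5.le)
      have h6 : (Q : ℝ) ^ (-(1 / 2) : ℝ) ≤ 2 * (g : ℝ) ^ (-(1 / 2) : ℝ) := by
        calc (Q : ℝ) ^ (-(1 / 2) : ℝ) ≤ ((g : ℝ) / 4) ^ (-(1 / 2) : ℝ) :=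
              Real.rpow_le_rpow_of_nonpos (by positivity) (by linarith) (by norm_num)
          _ = 2 * (g : ℝ) ^ (-(1 / 2) : ℝ) := by
            rw [div_eq_mul_inv, Real.mul_rpow hg0.le (by norm_num), mul_comm]
            congr 1
            rw [show ((4 : ℝ)⁻¹) = 2 ^ (-2 : ℝ) by
              rw [Real.rpow_neg (by norm_num)]; norm_num, ← Real.rpow_mul (by norm_num)]
            norm_num
      calc (Q : ℝ)⁻¹ = (Q : ℝ) ^ (-(1 / 2) : ℝ) * (Q : ℝ) ^ (-(1 / 2) : ℝ) := by
            rw [← Real.rpow_add (by linarith), ← Real.rpow_neg_one]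
            norm_num
        _ ≤ _ := mul_le_mul_of_nonneg_right h6 (by positivity)
    refine (sum_le_sum h3).trans ?_
    rw [← mul_sum]
    have h7 : ∑ Q ∈ A.filter (fun Q => ¬ Q.Prime), (Q : ℝ) ^ (-(1 / 2) : ℝ) ≤
        ∑ c ∈ Icc 1 Y ×ˢ Icc 1 (Nat.log 2 Y), (c.1 : ℝ)⁻¹ := by
      have hf : ∀ c ∈ Icc 1 Y ×ˢ Icc 1 (Nat.log 2 Y),
          ((c.1 ^ (c.2 + 1) : ℕ) : ℝ) ^ (-(1 / 2) : ℝ) ≤ (c.1 : ℝ)⁻¹ := by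
        intro c hc
        simp only [mem_product, mem_Icc] at hc
        have hc1 : (1 : ℝ) ≤ c.1 := by exact_mod_cast hc.1.1
        have hc2 : (1 : ℝ) ≤ c.2 := by exact_mod_cast hc.2.1
        push_cast
        rw [← Real.rpow_natCast, ← Real.rpow_mul (by linarith), ← Real.rpow_neg_one]
        refine Real.rpow_le_rpow_of_exponent_le hc1 ?_
        push_cast
        linarith
      refine le_trans ?_ (sum_le_sum hf)
      refine sum_le_sum_comp_of_cover _ (fun c : ℕ × ℕ => c.1 ^ (c.2 + 1))
        (fun Q : ℕ => (Q : ℝ) ^ (-(1 / 2) : ℝ)) (fun _ => by positivity) fun Q hQ => ?_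
      simp only [A, mem_filter, mem_Icc] at hQ
      obtain ⟨q, e, hq, he, rfl⟩ := (isPrimePow_nat_iff Q).1 hQ.1.2.1
      have he1 : e ≠ 1 := by
        rintro rfl
        exact hQ.2 (by simpa using hq)
      refine ⟨(q, e - 1), ?_, ?_⟩
      · simp only [mem_product, mem_Icc]
        refine ⟨⟨hq.pos, (Nat.le_self_pow he.ne' q).trans hQ.1.1.2⟩, by omega, ?_⟩
        have : e ≤ Nat.log 2 Y := Nat.le_log_of_pow_le (by norm_num)
          ((Nat.pow_le_pow_left hq.two_le e).trans hQ.1.1.2)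
        omega
      · simp only
        rw [Nat.sub_add_cancel he]
    have h8 : ∑ c ∈ Icc 1 Y ×ˢ Icc 1 (Nat.log 2 Y), (c.1 : ℝ)⁻¹ ≤
        harmonicSum (Y + 1) * Nat.log 2 Y := by
      rw [sum_product]
      simp only [sum_const, Nat.card_Icc, Nat.add_sub_cancel, nsmul_eq_mul]
      rw [← mul_sum, mul_comm]
      exact mul_le_mul_of_nonneg_right (harmonicSum_mono (by omega)) (by positivity)
    calc _ ≤ 2 * (g : ℝ) ^ (-(1 / 2) : ℝ) * (harmonicSum (Y + 1) * Nat.log 2 Y) :=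
          mul_le_mul_of_nonneg_left (h7.trans h8) (by positivity)
      _ = _ := by ring
  linarith

theorem sum_divisors_rpow_le {κ : ℝ} {d : ℕ} (hd : d ≠ 0)
    (h : ∀ p, p.Prime → p ∣ d → (p : ℝ) ^ (-(1 / 4) : ℝ) ≤ κ) :
    ∑ g ∈ d.divisors, (g : ℝ) ^ (-(1 / 4) : ℝ) ≤ (1 + κ) ^ Nat.log 2 d := by
  induction d using induction_on_primes with
  | zero => exact absurd rfl hd
  | one => simp
  | prime_mul p a hp ih =>
    have ha : a ≠ 0 := by rintro rfl; simp at hd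
    have hκ := h p hp (dvd_mul_right _ _)
    have hκ0 : 0 ≤ κ := le_trans (by positivity) hκ
    have h1 := ih ha fun q hq hqa => h q hq (hqa.mul_left p)
    have h2 : (p * a).divisors ⊆ a.divisors ∪ a.divisors.image (p * ·) := by
      intro g hg
      rw [Nat.mem_divisors] at hg
      simp only [mem_union, mem_image, Nat.mem_divisors]
      by_cases hpg : p ∣ g
      · obtain ⟨c, rfl⟩ := hpg
        exact Or.inr ⟨c, ⟨Nat.dvd_of_mul_dvd_mul_left hp.pos hg.1, ha⟩, rfl⟩
      · exact Or.inl ⟨((Nat.Prime.coprime_iff_not_dvd hp).2 hpg).symm.dvd_of_dvd_mul_left hg.1, ha⟩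
    have hinj : Set.InjOn (p * ·) (a.divisors : Set ℕ) := fun x _ y _ e =>
      Nat.eq_of_mul_eq_mul_left hp.pos e
    have hf : ∀ g : ℕ, 0 ≤ (g : ℝ) ^ (-(1 / 4) : ℝ) := fun g => by positivity
    have h3 : (1 + κ) ^ (Nat.log 2 a + 1) ≤ (1 + κ) ^ Nat.log 2 (p * a) := by
      refine pow_le_pow_right₀ (by linarith) ?_
      rw [← Nat.log_mul_base (by norm_num) ha]
      exact Nat.log_mono_right (by nlinarith [hp.two_le])
    calc _ ≤ ∑ g ∈ a.divisors ∪ a.divisors.image (p * ·), (g : ℝ) ^ (-(1 / 4) : ℝ) :=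
          sum_le_sum_of_subset_of_nonneg h2 fun g _ _ => hf g
      _ ≤ ∑ g ∈ a.divisors, (g : ℝ) ^ (-(1 / 4) : ℝ) +
          ∑ g ∈ a.divisors.image (p * ·), (g : ℝ) ^ (-(1 / 4) : ℝ) := by
        rw [← sum_union_inter]
        exact le_add_of_nonneg_right (sum_nonneg fun g _ => hf g)
      _ = (1 + (p : ℝ) ^ (-(1 / 4) : ℝ)) * ∑ g ∈ a.divisors, (g : ℝ) ^ (-(1 / 4) : ℝ) := by
        rw [sum_image hinj, add_mul, one_mul, mul_sum]
        congr 1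
        refine sum_congr rfl fun g _ => ?_
        push_cast
        exact Real.mul_rpow (by positivity) (by positivity)
      _ ≤ (1 + κ) * (1 + κ) ^ Nat.log 2 a := by
        refine mul_le_mul (by linarith) h1 (sum_nonneg fun g _ => hf g) (by linarith)
      _ ≤ _ := by rw [← pow_succ']; exact h3

/-- If `d > 1` divides `σ(b)`, some part of `d` divides `σ` of a prime power exactly dividing `b`. -/
theorem exists_primePow_mul_of_dvd_sigma {d b : ℕ} (hd0 : d ≠ 0) (hd : d ≠ 1) (hb : b ≠ 0)
    (h : d ∣ sigma 1 b) :
    ∃ g Q b', g ∣ d ∧ g ≠ 1 ∧ IsPrimePow Q ∧ g ∣ sigma 1 Q ∧ d / g ∣ sigma 1 b' ∧ Q * b' = b := by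
  have hex : ∃ q ∈ b.primeFactors, ¬ d.Coprime (sigma 1 (q ^ b.factorization q)) := by
    by_contra! hcon
    refine hd (Nat.dvd_one.1 ?_)
    have : d.Coprime (sigma 1 b) := by
      rw [isMultiplicative_sigma.multiplicative_factorization _ hb]
      exact Nat.Coprime.prod_right fun q hq => hcon q (by simpa using hq)
    exact (Nat.coprime_iff_gcd_eq_one.1 this) ▸ Nat.dvd_gcd dvd_rfl h
  obtain ⟨q, hq, hcop⟩ := hex
  have hqp := Nat.prime_of_mem_primeFactors hq
  have hqb := Nat.dvd_of_mem_primeFactors hq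
  have hv : b.factorization q ≠ 0 := (hqp.factorization_pos_of_dvd hb hqb).ne'
  set Q := q ^ b.factorization q with hQ
  have hmul : Q * (b / Q) = b := Nat.ordProj_mul_ordCompl_eq_self b q
  have hcopQ : Q.Coprime (b / Q) := (Nat.coprime_ordCompl hqp hb).pow_left _
  refine ⟨d.gcd (sigma 1 Q), Q, b / Q, Nat.gcd_dvd_left _ _, hcop, ?_, Nat.gcd_dvd_right _ _, ?_,
    hmul⟩
  · exact hqp.isPrimePow.pow hv
  · have h1 : sigma 1 b = sigma 1 Q * sigma 1 (b / Q) := by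
      rw [← isMultiplicative_sigma.map_mul_of_coprime hcopQ, hmul]
    rw [h1] at h
    have hg : 0 < d.gcd (sigma 1 Q) := Nat.gcd_pos_of_pos_left _ (Nat.pos_of_ne_zero hd0)
    refine (Nat.coprime_div_gcd_div_gcd hg).dvd_of_dvd_mul_left ?_
    refine Nat.dvd_of_mul_dvd_mul_left hg ?_
    rwa [Nat.mul_div_cancel' (Nat.gcd_dvd_left _ _), ← mul_assoc,
      Nat.mul_div_cancel' (Nat.gcd_dvd_right _ _)]

/-- Reciprocals of the integers `b ≤ Y` for which `σ(b)` is divisible by a rough number `d`. -/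
theorem sum_inv_dvd_sigma_le {Y E : ℕ} {κ : ℝ} (hκ0 : 0 ≤ κ)
    (hκ : 2 * harmonicSum (Y + 1) * (1 + Nat.log 2 Y) * ((1 + κ) ^ E - 1) ≤ 1)
    (d : ℕ) (hd : d ≠ 0) (hdE : Nat.log 2 d ≤ E)
    (hrough : ∀ p, p.Prime → p ∣ d → (p : ℝ) ^ (-(1 / 4) : ℝ) ≤ κ) :
    ∑ b ∈ (Icc 1 Y).filter (fun b => d ∣ sigma 1 b), (b : ℝ)⁻¹ ≤
      harmonicSum Y * (d : ℝ) ^ (-(1 / 4) : ℝ) := by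
  classical
  induction d using Nat.strong_induction_on with
  | _ d ih =>
  have hHY : 0 ≤ harmonicSum Y := sum_nonneg fun _ _ => by positivity
  rcases eq_or_ne d 1 with rfl | hd1
  · simp [harmonicSum]
  set G := d.divisors.erase 1
  set K := 2 * harmonicSum (Y + 1) * (1 + Nat.log 2 Y)
  have hK : 0 ≤ K := by
    have : 0 ≤ harmonicSum (Y + 1) := zero_le_one.trans (one_le_harmonicSum (by omega))
    positivity
  have hG : ∀ g ∈ G, g ≠ 1 ∧ g ∣ d ∧ 0 < g := fun g hg => by
    have h1 := Nat.mem_divisors.1 (mem_erase.1 hg).2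
    exact ⟨(mem_erase.1 hg).1, h1.1, Nat.pos_of_dvd_of_pos h1.1 (Nat.pos_of_ne_zero hd)⟩
  calc _ ≤ ∑ c ∈ G.sigma (fun g => (Icc 1 Y).filter (fun Q => IsPrimePow Q ∧ g ∣ sigma 1 Q) ×ˢ
          (Icc 1 Y).filter (fun b => d / g ∣ sigma 1 b)), (((c.2.1 * c.2.2 : ℕ) : ℝ))⁻¹ := by
        refine sum_le_sum_comp_of_cover _ (fun c : (_ : ℕ) × (ℕ × ℕ) => c.2.1 * c.2.2)
          (fun b : ℕ => (b : ℝ)⁻¹) (fun _ => by positivity) fun b hb => ?_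
        simp only [mem_filter, mem_Icc] at hb
        obtain ⟨g, Q, b', hgd, hg1, hQ, hgQ, hgb, rfl⟩ :=
          exists_primePow_mul_of_dvd_sigma hd hd1 (by omega) hb.2
        have hb0 : 0 < b' := Nat.pos_of_mul_pos_left hb.1.1
        refine ⟨⟨g, Q, b'⟩, ?_, rfl⟩
        simp only [mem_sigma, mem_product, mem_filter, mem_Icc, G, mem_erase, Nat.mem_divisors]
        exact ⟨⟨hg1, hgd, hd⟩, ⟨⟨hQ.pos, (Nat.le_mul_of_pos_right _ hb0).trans hb.1.2⟩, hQ, hgQ⟩,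
          ⟨hb0, (Nat.le_mul_of_pos_left _ hQ.pos).trans hb.1.2⟩, hgb⟩
    _ = ∑ g ∈ G, (∑ Q ∈ (Icc 1 Y).filter (fun Q => IsPrimePow Q ∧ g ∣ sigma 1 Q), (Q : ℝ)⁻¹) *
          ∑ b ∈ (Icc 1 Y).filter (fun b => d / g ∣ sigma 1 b), (b : ℝ)⁻¹ := by
        rw [sum_sigma]
        refine sum_congr rfl fun g _ => ?_
        rw [sum_mul_sum, ← sum_product']
        refine sum_congr rfl fun c _ => ?_
        push_cast
        rw [mul_inv]
    _ ≤ ∑ g ∈ G, (K * ((g : ℝ) ^ (-(1 / 4) : ℝ)) ^ 2) *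
          (harmonicSum Y * ((d / g : ℕ) : ℝ) ^ (-(1 / 4) : ℝ)) := by
        refine sum_le_sum fun g hg => ?_
        obtain ⟨hg1, hgd, hg0⟩ := hG g hg
        have hdg : d / g ∣ d := Nat.div_dvd_of_dvd hgd
        refine mul_le_mul (sum_inv_primePow_dvd_sigma_le Y g hg0) (ih (d / g) ?_ ?_ ?_ ?_)
          (sum_nonneg fun _ _ => by positivity) (by positivity)
        · exact Nat.div_lt_self (Nat.pos_of_ne_zero hd) (by omega)
        · exact (Nat.div_pos (Nat.le_of_dvd (Nat.pos_of_ne_zero hd) hgd) hg0).ne'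
        · exact (Nat.log_mono_right (Nat.div_le_self d g)).trans hdE
        · exact fun p hp hpd => hrough p hp (hpd.trans hdg)
    _ = harmonicSum Y * (d : ℝ) ^ (-(1 / 4) : ℝ) * (K * ∑ g ∈ G, (g : ℝ) ^ (-(1 / 4) : ℝ)) := by
        rw [mul_sum, mul_sum]
        refine sum_congr rfl fun g hg => ?_
        obtain ⟨hg1, hgd, hg0⟩ := hG g hg
        have : (d : ℝ) ^ (-(1 / 4) : ℝ) =
            (g : ℝ) ^ (-(1 / 4) : ℝ) * ((d / g : ℕ) : ℝ) ^ (-(1 / 4) : ℝ) := by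
          rw [← Real.mul_rpow (by positivity) (by positivity), ← Nat.cast_mul,
            Nat.mul_div_cancel' hgd]
        rw [this]
        ring
    _ ≤ harmonicSum Y * (d : ℝ) ^ (-(1 / 4) : ℝ) * 1 := by
        refine mul_le_mul_of_nonneg_left (le_trans ?_ hκ) (by positivity)
        refine mul_le_mul_of_nonneg_left ?_ hK
        have h1 := sum_divisors_rpow_le hd hrough
        rw [← add_sum_erase _ _ (Nat.one_mem_divisors.2 hd)] at h1
        have h2 : (1 + κ) ^ Nat.log 2 d ≤ (1 + κ) ^ E := pow_le_pow_right₀ (by linarith) hdE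
        simp only [Nat.cast_one, Real.one_rpow] at h1
        linarith
    _ = _ := mul_one _

theorem sigma_one_mul_prime {a p : ℕ} (hp : p.Prime) (hpa : ¬ p ∣ a) :
    sigma 1 (a * p) = sigma 1 a * (p + 1) := by
  rw [isMultiplicative_sigma.map_mul_of_coprime ((Nat.Prime.coprime_iff_not_dvd hp).2 hpa).symm]
  congr 1
  rw [← pow_one p, sigma_one_apply_prime_pow hp]
  simp [sum_range_succ, add_comm]

/-- Unless consecutive multiply perfect numbers exist, a solution `n = a p`, `n + 1 = b q` is
determined by `a` and `b`. -/
theorem eq_of_mul_prime_eq_succ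
    (h : ¬ ∃ m : ℕ, 1 ≤ m ∧ m ∣ sigma 1 m ∧ (m + 1) ∣ sigma 1 (m + 1))
    {a b p q p' q' : ℕ} (ha : 0 < a) (hb : 0 < b)
    (hp : p.Prime) (hq : q.Prime) (hp' : p'.Prime) (hq' : q'.Prime)
    (hpa : ¬ p ∣ a) (hqb : ¬ q ∣ b) (hpa' : ¬ p' ∣ a) (hqb' : ¬ q' ∣ b)
    (e : a * p + 1 = b * q) (e' : a * p' + 1 = b * q')
    (s : sigma 1 (a * p) = sigma 1 (b * q)) (s' : sigma 1 (a * p') = sigma 1 (b * q')) :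
    p = p' := by
  by_contra hne
  rw [sigma_one_mul_prime hp hpa, sigma_one_mul_prime hq hqb] at s
  rw [sigma_one_mul_prime hp' hpa', sigma_one_mul_prime hq' hqb'] at s'
  set A := sigma 1 a with hA
  set B := sigma 1 b with hB
  have hne' : ((p : ℤ) - p') ≠ 0 := by
    rw [sub_ne_zero]
    exact_mod_cast hne
  have hBA : b * A = a * B := by
    zify at e e' s s' ⊢
    refine mul_right_cancel₀ hne' ?_
    linear_combination (b : ℤ) * s - (b : ℤ) * s' - (B : ℤ) * e + (B : ℤ) * e'
  have hcop : a.Coprime b := by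
    have h1 : (a * p).Coprime (b * q) := by
      rw [← e]
      exact (Nat.coprime_self_add_right).2 (Nat.coprime_one_right _)
    exact (h1.coprime_dvd_left (dvd_mul_right _ _)).coprime_dvd_right (dvd_mul_right _ _)
  have haA : a ∣ A := hcop.dvd_of_dvd_mul_left (hBA ▸ dvd_mul_right a B)
  obtain ⟨r, hr⟩ := haA
  have hBr : B = b * r := by
    refine Nat.eq_of_mul_eq_mul_left ha ?_
    rw [← hBA, hr]
    ring
  have hr0 : 0 < r := by
    have : 0 < A := sigma_pos 1 a ha.ne'
    rw [hr] at this
    exact Nat.pos_of_mul_pos_left this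
  have hab : a = b + 1 := by
    have h1 : a * (p + 1) = b * (q + 1) := by
      refine Nat.eq_of_mul_eq_mul_left hr0 ?_
      rw [hr, hBr] at s
      linarith
    nlinarith
  exact h ⟨b, hb, ⟨r, hBr⟩, ⟨r, by rw [← hab]; exact hr⟩⟩

open scoped Classical in
theorem card_filter_add_smooth_le (N y i : ℕ) (hi : i ≤ 1) {Z : ℝ} (hZ : 0 ≤ Z) :
    (((Icc 1 N).filter (fun n => n + i ∈ y.smoothNumbers)).card : ℝ) ≤
      Z + (N + 1) * smoothTail (N + 1) y Z := by
  have h1 := card_filter_smooth_le (N + 1) y hZ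
  push_cast at h1
  refine le_trans ?_ h1
  have h2 : ((Icc 1 N).filter (fun n => n + i ∈ y.smoothNumbers)).card ≤
      ((Icc 1 (N + 1)).filter (· ∈ y.smoothNumbers)).card := by
    refine card_le_card_of_injOn (· + i) (fun n hn => ?_) (fun n _ n' _ e => by simpa using e)
    simp only [coe_filter, mem_Icc, Set.mem_ofPred_eq] at hn ⊢
    exact ⟨⟨by omega, by omega⟩, hn.2⟩
  exact_mod_cast h2

open scoped Classical in
theorem card_filter_sq_dvd_le (N y i : ℕ) (hi : i ≤ 1) (hy : 0 < y) :
    (((Icc 1 N).filter (fun n => ∃ p, y ≤ p ∧ p ^ 2 ∣ n + i)).card : ℝ) ≤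
      (N + 1) * harmonicSum (N + 1) / y := by
  have hy0 : (0 : ℝ) < y := by exact_mod_cast hy
  have h1 := card_le_sum_of_forall_exists
    (S := (Icc 1 N).filter (fun n => ∃ p, y ≤ p ∧ p ^ 2 ∣ n + i)) (Icc y (N + 1))
    (fun p => (Icc 1 N).filter fun n => p ^ 2 ∣ n + i) (fun p => (N + 1) / y * (p : ℝ)⁻¹)
    (fun p hp => ?_) (fun n hn => ?_)
  · refine h1.trans ?_
    rw [← mul_sum, mul_div_right_comm]
    refine mul_le_mul_of_nonneg_left ?_ (by positivity)
    exact sum_le_sum_of_subset_of_nonneg (Icc_subset_Icc_left hy) fun _ _ _ => by positivity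
  · rw [mem_Icc] at hp
    have hyp : (y : ℝ) ≤ p := by exact_mod_cast hp.1
    have hp0 : (0 : ℝ) < p := hy0.trans_le hyp
    refine (card_filter_dvd_add_le N i (p ^ 2) hi (by have := hy.trans_le hp.1; positivity)).trans ?_
    rw [← div_eq_mul_inv, div_div]
    push_cast
    rw [sq]
    gcongr
  · simp only [mem_filter, mem_Icc] at hn
    obtain ⟨hn1, p, hyp, hpn⟩ := hn
    refine ⟨p, mem_Icc.2 ⟨hyp, ?_⟩, mem_filter.2 ⟨mem_Icc.2 hn1, hpn⟩⟩
    have := Nat.le_of_dvd (by omega) hpn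
    exact (Nat.le_self_pow two_ne_zero p).trans (by omega)

open scoped Classical in
theorem card_filter_smooth_dvd_succ_le (N w i : ℕ) (hi : i ≤ 1) (z : ℝ) :
    (((Icc 1 N).filter (fun n => ∃ p s, p.Prime ∧ p ∣ n + i ∧ s ∣ p + 1 ∧ s ∈ w.smoothNumbers ∧
      z < s)).card : ℝ) ≤ 2 * (N + 1) * harmonicSum (N + 2) * smoothTail (N + 2) w z := by
  have h1 := card_le_sum_of_forall_exists
    (S := (Icc 1 N).filter (fun n => ∃ p s, p.Prime ∧ p ∣ n + i ∧ s ∣ p + 1 ∧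
      s ∈ w.smoothNumbers ∧ z < s))
    (((Icc 1 (N + 2)).filter (fun s => s ∈ w.smoothNumbers ∧ z < s)).sigma
      fun s => (Icc 1 (N + 1)).filter fun p => s ∣ p + 1)
    (fun c => (Icc 1 N).filter fun n => c.2 ∣ n + i) (fun c => (N + 1) * (c.2 : ℝ)⁻¹)
    (fun c hc => ?_) (fun n hn => ?_)
  · refine h1.trans ?_
    rw [sum_sigma, smoothTail, mul_sum]
    refine sum_le_sum fun s hs => ?_
    rw [← mul_sum]
    simp only [mem_filter, mem_Icc] at hs
    calc _ ≤ ((N : ℝ) + 1) * (2 * harmonicSum (N + 2) / s) :=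
          mul_le_mul_of_nonneg_left (sum_inv_filter_dvd_succ_le (N + 1) s hs.1.1) (by positivity)
      _ = _ := by ring
  · simp only [mem_sigma, mem_filter, mem_Icc] at hc
    rw [← div_eq_mul_inv]
    exact card_filter_dvd_add_le N i c.2 hi hc.2.1.1
  · simp only [mem_filter, mem_Icc] at hn
    obtain ⟨hn1, p, s, hp, hpn, hsp, hsw, hzs⟩ := hn
    have hpN : p ≤ N + 1 := (Nat.le_of_dvd (by omega) hpn).trans (by omega)
    have hsN : s ≤ p + 1 := Nat.le_of_dvd (by omega) hsp
    refine ⟨⟨s, p⟩, ?_, ?_⟩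
    · simp only [mem_sigma, mem_filter, mem_Icc]
      exact ⟨⟨⟨Nat.pos_of_dvd_of_pos hsp (by omega), by omega⟩, hsw, hzs⟩, ⟨hp.pos, hpN⟩, hsp⟩
    · exact mem_filter.2 ⟨mem_Icc.2 hn1, hpn⟩

open scoped Classical in
theorem card_filter_exists_cofactors_le
    (h : ¬ ∃ m : ℕ, 1 ≤ m ∧ m ∣ sigma 1 m ∧ (m + 1) ∣ sigma 1 (m + 1))
    (N : ℕ) {M : ℝ} (hM : 0 ≤ M) :
    (((Icc 1 N).filter (fun n => sigma 1 n = sigma 1 (n + 1) ∧ ∃ a b p q : ℕ, p.Prime ∧ q.Prime ∧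
      ¬ p ∣ a ∧ ¬ q ∣ b ∧ n = a * p ∧ n + 1 = b * q ∧ (a * b : ℝ) ≤ M)).card : ℝ) ≤
      M * harmonicSum (N + 1) := by
  refine (card_le_sum_of_forall_exists
    ((Icc 1 (N + 1) ×ˢ Icc 1 (N + 1)).filter fun c : ℕ × ℕ => (c.1 * c.2 : ℝ) ≤ M)
    (fun c : ℕ × ℕ => (Icc 1 N).filter (fun n => sigma 1 n = sigma 1 (n + 1) ∧ ∃ p q : ℕ, p.Prime ∧
      q.Prime ∧ ¬ p ∣ c.1 ∧ ¬ q ∣ c.2 ∧ n = c.1 * p ∧ n + 1 = c.2 * q)) (fun _ => 1)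
    (fun c _ => ?_) (fun n hn => ?_)).trans ?_
  · have : ((Icc 1 N).filter (fun n => sigma 1 n = sigma 1 (n + 1) ∧ ∃ p q : ℕ, p.Prime ∧
      q.Prime ∧ ¬ p ∣ c.1 ∧ ¬ q ∣ c.2 ∧ n = c.1 * p ∧ n + 1 = c.2 * q)).card ≤ 1 := by
      rw [card_le_one]
      intro n hn n' hn'
      simp only [mem_filter, mem_Icc] at hn hn'
      obtain ⟨hn1, hs, p, q, hp, hq, hpa, hqb, rfl, e⟩ := hn
      obtain ⟨hn1', hs', p', q', hp', hq', hpa', hqb', rfl, e'⟩ := hn'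
      rw [e] at hs
      rw [e'] at hs'
      rw [eq_of_mul_prime_eq_succ h (Nat.pos_of_mul_pos_right hn1.1)
        (Nat.pos_of_mul_pos_right (Nat.lt_of_lt_of_eq (Nat.succ_pos _) e)) hp hq hp' hq' hpa hqb hpa' hqb' e e' hs hs']
    exact_mod_cast this
  · simp only [mem_filter, mem_Icc] at hn
    obtain ⟨hn1, hs, a, b, p, q, hp, hq, hpa, hqb, ha, hb, hab⟩ := hn
    have ha1 : a ∣ n := ⟨p, ha⟩
    have hb1 : b ∣ n + 1 := ⟨q, hb⟩
    have ha2 := Nat.le_of_dvd (by omega) ha1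
    have hb2 := Nat.le_of_dvd (by omega) hb1
    refine ⟨(a, b), ?_, ?_⟩
    · simp only [mem_filter, mem_product, mem_Icc]
      exact ⟨⟨⟨Nat.pos_of_dvd_of_pos ha1 (by omega), by omega⟩,
        Nat.pos_of_dvd_of_pos hb1 (by omega), by omega⟩, hab⟩
    · simp only [mem_filter, mem_Icc]
      exact ⟨hn1, hs, p, q, hp, hq, hpa, hqb, ha, hb⟩
  · rw [sum_const, nsmul_eq_mul, mul_one]
    convert card_filter_mul_le (N + 1) M hM

theorem sum_inv_le_of_subset_Icc {S : Finset ℕ} {Y : ℕ} (h : S ⊆ Icc 1 Y) :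
    ∑ d ∈ S, (d : ℝ)⁻¹ ≤ harmonicSum Y :=
  sum_le_sum_of_subset_of_nonneg h fun _ _ _ => by positivity

open scoped Classical in
theorem card_filter_dvd_succ_dvd_succ_le (N : ℕ) {V : ℝ} (hV : 1 ≤ V) :
    (((Icc 1 N).filter (fun n => ∃ d p q : ℕ, V ^ 4 ≤ d ∧ d ∣ p + 1 ∧ d ∣ q + 1 ∧ p ∣ n ∧
      q ∣ n + 1 ∧ (p * q : ℝ) ≤ (N + 1) * V)).card : ℝ) ≤
      8 * (N + 1) * harmonicSum (N + 2) ^ 3 / V := by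
  set H := harmonicSum (N + 2)
  have hH : 0 ≤ H := zero_le_one.trans (one_le_harmonicSum (by omega))
  set D := (Icc 1 (N + 2)).filter (fun d : ℕ => V ^ 4 ≤ d)
  set P : ℕ → Finset ℕ := fun d => (Icc 1 (N + 1)).filter fun p => d ∣ p + 1
  have h1 := card_le_sum_of_forall_exists
    (S := (Icc 1 N).filter (fun n => ∃ d p q : ℕ, V ^ 4 ≤ d ∧ d ∣ p + 1 ∧ d ∣ q + 1 ∧ p ∣ n ∧
      q ∣ n + 1 ∧ (p * q : ℝ) ≤ (N + 1) * V))
    (D.sigma fun d => (P d ×ˢ P d).filter fun c : ℕ × ℕ => c.1.Coprime c.2 ∧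
      (c.1 * c.2 : ℝ) ≤ (N + 1) * V)
    (fun c => (Icc 1 N).filter fun n => c.2.1 ∣ n + 0 ∧ c.2.2 ∣ n + 1)
    (fun c => 2 * (N + 1) * V * ((c.2.1 : ℝ)⁻¹ * (c.2.2 : ℝ)⁻¹)) (fun c hc => ?_) (fun n hn => ?_)
  · refine h1.trans ?_
    rw [sum_sigma]
    calc _ ≤ ∑ d ∈ D, 8 * ((N : ℝ) + 1) * H ^ 2 / V * (d : ℝ)⁻¹ := by
          refine sum_le_sum fun d hd => ?_
          simp only [D, mem_filter, mem_Icc] at hd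
          have hd0 : (0 : ℝ) < d := by exact_mod_cast hd.1.1
          have hPd := sum_inv_filter_dvd_succ_le (N + 1) d hd.1.1
          calc _ ≤ ∑ c ∈ P d ×ˢ P d, 2 * ((N : ℝ) + 1) * V * ((c.1 : ℝ)⁻¹ * (c.2 : ℝ)⁻¹) :=
                sum_le_sum_of_subset_of_nonneg (filter_subset _ _) fun _ _ _ => by positivity
            _ = 2 * ((N : ℝ) + 1) * V * ((∑ p ∈ P d, (p : ℝ)⁻¹) * ∑ p ∈ P d, (p : ℝ)⁻¹) := by
                rw [← mul_sum, sum_mul_sum, ← sum_product']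
            _ ≤ 2 * ((N : ℝ) + 1) * V * (2 * H / d * (2 * H / d)) := by
                have : 0 ≤ ∑ p ∈ P d, (p : ℝ)⁻¹ := sum_nonneg fun _ _ => by positivity
                gcongr
            _ = 8 * ((N : ℝ) + 1) * H ^ 2 * V * (d : ℝ)⁻¹ * (d : ℝ)⁻¹ := by ring
            _ ≤ 8 * ((N : ℝ) + 1) * H ^ 2 * V * (d : ℝ)⁻¹ * (V ^ 2)⁻¹ := by
                gcongr
                exact (pow_le_pow_right₀ hV (by norm_num)).trans hd.2
            _ = _ := by field_simp
      _ = 8 * ((N : ℝ) + 1) * H ^ 2 / V * ∑ d ∈ D, (d : ℝ)⁻¹ := by rw [mul_sum]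
      _ ≤ 8 * ((N : ℝ) + 1) * H ^ 2 / V * H := by
          gcongr
          exact sum_inv_le_of_subset_Icc (filter_subset _ _)
      _ = _ := by ring
  · simp only [mem_sigma, mem_filter, mem_product, mem_Icc, P] at hc
    obtain ⟨-, ⟨⟨⟨hp1, -⟩, -⟩, ⟨hq1, -⟩, -⟩, hcop, hle⟩ := hc
    have hp0 : (0 : ℝ) < c.2.1 := by exact_mod_cast hp1
    have hq0 : (0 : ℝ) < c.2.2 := by exact_mod_cast hq1
    refine (card_filter_dvd_add_dvd_add_le N 0 1 _ _ hcop).trans ?_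
    rw [← mul_inv, ← div_eq_mul_inv, le_div_iff₀ (by positivity), add_mul,
      div_mul_cancel₀ _ (by positivity)]
    nlinarith [(Nat.cast_nonneg N : (0 : ℝ) ≤ N)]
  · simp only [mem_filter, mem_Icc] at hn
    obtain ⟨hn1, d, p, q, hdV, hdp, hdq, hpn, hqn, hpq⟩ := hn
    have hpN := Nat.le_of_dvd (by omega) hpn
    have hqN := Nat.le_of_dvd (by omega) hqn
    have hdN := Nat.le_of_dvd (by omega) hdp
    refine ⟨⟨d, p, q⟩, ?_, ?_⟩
    · simp only [mem_sigma, mem_filter, mem_product, mem_Icc, P, D]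
      have hp0 := Nat.pos_of_dvd_of_pos hpn (by omega)
      have hq0 := Nat.pos_of_dvd_of_pos hqn (by omega)
      have hd0 := Nat.pos_of_dvd_of_pos hdp (by omega)
      refine ⟨⟨⟨hd0, by omega⟩, hdV⟩, ⟨⟨⟨hp0, by omega⟩, hdp⟩, ⟨hq0, by omega⟩, hdq⟩, ?_, hpq⟩
      exact (((Nat.coprime_self_add_right (m := n)).2
        (Nat.coprime_one_right n)).coprime_dvd_left hpn).coprime_dvd_right hqn
    · exact mem_filter.2 ⟨mem_Icc.2 hn1, hpn, hqn⟩

open scoped Classical in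
theorem card_filter_dvd_succ_dvd_sigma_le (N w i j : ℕ) (hi : i ≤ 1) (hj : j ≤ 1) {V κ : ℝ}
    (hV : 1 ≤ V) (hw : 0 < w) (hwκ : (w : ℝ) ^ (-(1 / 4) : ℝ) ≤ κ)
    (hκ : 2 * harmonicSum (N + 2) * (1 + Nat.log 2 (N + 1)) *
      ((1 + κ) ^ Nat.log 2 (N + 2) - 1) ≤ 1) :
    (((Icc 1 N).filter (fun n => ∃ d p b : ℕ, V ^ 4 ≤ d ∧ (∀ r, r.Prime → r ∣ d → w ≤ r) ∧
      d ∣ p + 1 ∧ d ∣ sigma 1 b ∧ p ∣ n + i ∧ b ∣ n + j ∧ p.Coprime b ∧ p * b ≤ N + 1)).card : ℝ) ≤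
      4 * (N + 1) * harmonicSum (N + 2) ^ 3 / V := by
  have hV0 : 0 < V := by linarith
  set H := harmonicSum (N + 2)
  have hH : 0 ≤ H := zero_le_one.trans (one_le_harmonicSum (by omega))
  set D := (Icc 1 (N + 2)).filter (fun d : ℕ => V ^ 4 ≤ d ∧ ∀ r, r.Prime → r ∣ d → w ≤ r)
  set P : ℕ → Finset ℕ := fun d => (Icc 1 (N + 1)).filter fun p => d ∣ p + 1
  set B : ℕ → Finset ℕ := fun d => (Icc 1 (N + 1)).filter fun b => d ∣ sigma 1 b
  have h1 := card_le_sum_of_forall_exists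
    (S := (Icc 1 N).filter (fun n => ∃ d p b : ℕ, V ^ 4 ≤ d ∧ (∀ r, r.Prime → r ∣ d → w ≤ r) ∧
      d ∣ p + 1 ∧ d ∣ sigma 1 b ∧ p ∣ n + i ∧ b ∣ n + j ∧ p.Coprime b ∧ p * b ≤ N + 1))
    (D.sigma fun d => (P d ×ˢ B d).filter fun c : ℕ × ℕ => c.1.Coprime c.2 ∧
      c.1 * c.2 ≤ N + 1)
    (fun c => (Icc 1 N).filter fun n => c.2.1 ∣ n + i ∧ c.2.2 ∣ n + j)
    (fun c => 2 * (N + 1) * ((c.2.1 : ℝ)⁻¹ * (c.2.2 : ℝ)⁻¹)) (fun c hc => ?_) (fun n hn => ?_)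
  · refine h1.trans ?_
    rw [sum_sigma]
    calc _ ≤ ∑ d ∈ D, 4 * ((N : ℝ) + 1) * H ^ 2 / V * (d : ℝ)⁻¹ := by
          refine sum_le_sum fun d hd => ?_
          simp only [D, mem_filter, mem_Icc] at hd
          have hd0 : (0 : ℝ) < d := by exact_mod_cast hd.1.1
          have hPd : ∑ p ∈ P d, (p : ℝ)⁻¹ ≤ 2 * H / d :=
            sum_inv_filter_dvd_succ_le (N + 1) d hd.1.1
          have hBd : ∑ b ∈ B d, (b : ℝ)⁻¹ ≤ H * V⁻¹ := by
            have hκ0 : 0 ≤ κ := le_trans (by positivity) hwκ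
            refine (sum_inv_dvd_sigma_le (Y := N + 1) hκ0 hκ d (by omega)
              (Nat.log_mono_right hd.1.2) fun r hr hrd => ?_).trans ?_
            · refine le_trans (Real.rpow_le_rpow_of_nonpos (by exact_mod_cast hw) ?_ (by norm_num))
                hwκ
              exact_mod_cast hd.2.2 r hr hrd
            · have h2 : (d : ℝ) ^ (-(1 / 4) : ℝ) ≤ V⁻¹ := by
                calc (d : ℝ) ^ (-(1 / 4) : ℝ) ≤ (V ^ 4) ^ (-(1 / 4) : ℝ) :=
                      Real.rpow_le_rpow_of_nonpos (by positivity) hd.2.1 (by norm_num)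
                  _ = V⁻¹ := by
                    rw [← Real.rpow_natCast, ← Real.rpow_mul hV0.le, ← Real.rpow_neg_one]
                    norm_num
              exact mul_le_mul (harmonicSum_mono (by omega)) h2 (by positivity) hH
          calc _ ≤ ∑ c ∈ P d ×ˢ B d, 2 * ((N : ℝ) + 1) * ((c.1 : ℝ)⁻¹ * (c.2 : ℝ)⁻¹) :=
                sum_le_sum_of_subset_of_nonneg (filter_subset _ _) fun _ _ _ => by positivity
            _ = 2 * ((N : ℝ) + 1) * ((∑ p ∈ P d, (p : ℝ)⁻¹) * ∑ p ∈ B d, (p : ℝ)⁻¹) := by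
                rw [← mul_sum, sum_mul_sum, ← sum_product']
            _ ≤ 2 * ((N : ℝ) + 1) * (2 * H / d * (H * V⁻¹)) := by
                have : 0 ≤ ∑ p ∈ B d, (p : ℝ)⁻¹ := sum_nonneg fun _ _ => by positivity
                gcongr
            _ = _ := by ring
      _ = 4 * ((N : ℝ) + 1) * H ^ 2 / V * ∑ d ∈ D, (d : ℝ)⁻¹ := by rw [mul_sum]
      _ ≤ 4 * ((N : ℝ) + 1) * H ^ 2 / V * H := by
          gcongr
          exact sum_inv_le_of_subset_Icc (filter_subset _ _)
      _ = _ := by ring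
  · simp only [mem_sigma, mem_filter, mem_product, mem_Icc, P, B] at hc
    obtain ⟨-, ⟨⟨⟨hp1, -⟩, -⟩, ⟨hq1, -⟩, -⟩, hcop, hle⟩ := hc
    have hp0 : (0 : ℝ) < c.2.1 := by exact_mod_cast hp1
    have hq0 : (0 : ℝ) < c.2.2 := by exact_mod_cast hq1
    have hle' : (c.2.1 * c.2.2 : ℝ) ≤ N + 1 := by exact_mod_cast hle
    refine (card_filter_dvd_add_dvd_add_le N i j _ _ hcop).trans ?_
    rw [← mul_inv, ← div_eq_mul_inv, le_div_iff₀ (by positivity), add_mul,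
      div_mul_cancel₀ _ (by positivity)]
    linarith
  · simp only [mem_filter, mem_Icc] at hn
    obtain ⟨hn1, d, p, b, hdV, hdw, hdp, hdb, hpn, hbn, hcop, hpb⟩ := hn
    have hpN := Nat.le_of_dvd (by omega) hpn
    have hbN := Nat.le_of_dvd (by omega) hbn
    have hdN := Nat.le_of_dvd (by omega) hdp
    refine ⟨⟨d, p, b⟩, ?_, mem_filter.2 ⟨mem_Icc.2 hn1, hpn, hbn⟩⟩
    simp only [mem_sigma, mem_filter, mem_product, mem_Icc, P, B, D]
    have hp0 := Nat.pos_of_dvd_of_pos hpn (by omega)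
    have hb0 := Nat.pos_of_dvd_of_pos hbn (by omega)
    have hd0 := Nat.pos_of_dvd_of_pos hdp (by omega)
    exact ⟨⟨⟨hd0, by omega⟩, hdV, hdw⟩, ⟨⟨⟨hp0, by omega⟩, hdp⟩, ⟨hb0, by omega⟩, hdb⟩, hcop, hpb⟩

/-- If `σ(a p) = σ(b q)` and the smooth part of `p + 1` is small, then a large rough divisor of
`p + 1` divides `q + 1` or `σ(b)`. -/
theorem exists_rough_dvd {a b p q y w : ℕ} {V z : ℝ} (hz : 0 < z)
    (hy : z * V ^ 8 ≤ y) (hp : p.Prime) (hq : q.Prime) (hpa : ¬ p ∣ a) (hqb : ¬ q ∣ b)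
    (hyp : y ≤ p) (hs : sigma 1 (a * p) = sigma 1 (b * q))
    (hsm : ∀ s, s ∣ p + 1 → s ∈ w.smoothNumbers → (s : ℝ) ≤ z) :
    ∃ d : ℕ, V ^ 4 ≤ d ∧ (∀ r, r.Prime → r ∣ d → w ≤ r) ∧ d ∣ p + 1 ∧
      (d ∣ q + 1 ∨ d ∣ sigma 1 b) := by
  obtain ⟨s, d, hsd, hsw, hdw⟩ := exists_smooth_mul_rough w (n := p + 1) (by omega)
  have hdp : d ∣ p + 1 := hsd ▸ dvd_mul_left d s
  have hd0 : 0 < d := Nat.pos_of_dvd_of_pos hdp (by omega)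
  have hsz := hsm s (hsd ▸ dvd_mul_right s d) hsw
  have hdV : V ^ 8 ≤ d := by
    refine le_of_mul_le_mul_left ?_ hz
    have h1 : ((p + 1 : ℕ) : ℝ) = s * d := by rw [hsd]; push_cast; rfl
    have h2 : (y : ℝ) ≤ p := by exact_mod_cast hyp
    push_cast at h1
    calc z * V ^ 8 ≤ s * d := by linarith
      _ ≤ z * d := by gcongr
  rw [sigma_one_mul_prime hp hpa, sigma_one_mul_prime hq hqb] at hs
  have hdvd : d ∣ (q + 1) * sigma 1 b := by
    rw [mul_comm, ← hs]
    exact hdp.mul_left _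
  obtain ⟨d₁, d₂, h₁, h₂, rfl⟩ := exists_dvd_and_dvd_of_dvd_mul hdvd
  push_cast at hdV
  rcases le_or_gt (V ^ 4) d₁ with h | h
  · exact ⟨d₁, h, fun r hr hrd => hdw r hr (hrd.mul_right _), (dvd_mul_right _ _).trans hdp,
      Or.inl h₁⟩
  · refine ⟨d₂, ?_, fun r hr hrd => hdw r hr (hrd.mul_left _), (dvd_mul_left _ _).trans hdp,
      Or.inr h₂⟩
    by_contra! h'
    have : (d₁ : ℝ) * d₂ < V ^ 4 * V ^ 4 := by gcongr
    nlinarith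

open scoped Classical in
/-- The solutions of `σ(n) = σ(n + 1)` up to `N`, in terms of free parameters. -/
theorem card_filter_sigma_eq_le
    (h : ¬ ∃ m : ℕ, 1 ≤ m ∧ m ∣ sigma 1 m ∧ (m + 1) ∣ sigma 1 (m + 1))
    (N y w : ℕ) {V Z z κ : ℝ} (hV : 1 ≤ V) (hZ : 0 ≤ Z) (hz : 0 < z) (hw : 0 < w)
    (hy : z * V ^ 8 ≤ y) (hwκ : (w : ℝ) ^ (-(1 / 4) : ℝ) ≤ κ)
    (hκ : 2 * harmonicSum (N + 2) * (1 + Nat.log 2 (N + 1)) *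
      ((1 + κ) ^ Nat.log 2 (N + 2) - 1) ≤ 1) :
    (((Icc 1 N).filter (fun n => sigma 1 n = sigma 1 (n + 1))).card : ℝ) ≤
      2 * (Z + (N + 1) * smoothTail (N + 1) y Z) + 2 * ((N + 1) * harmonicSum (N + 1) / y) +
      2 * (2 * (N + 1) * harmonicSum (N + 2) * smoothTail (N + 2) w z) +
      (N + 1) / V * harmonicSum (N + 1) +
      16 * (N + 1) * harmonicSum (N + 2) ^ 3 / V := by
  have hy0 : 0 < y := by
    have : (0 : ℝ) < y := lt_of_lt_of_le (by positivity) hy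
    exact_mod_cast this
  set S₀ : ℕ → Finset ℕ := fun i => (Icc 1 N).filter (fun n => n + i ∈ y.smoothNumbers) with hS₀
  set S₁ : ℕ → Finset ℕ := fun i =>
    (Icc 1 N).filter (fun n => ∃ p, y ≤ p ∧ p ^ 2 ∣ n + i) with hS₁
  set S₂ : ℕ → Finset ℕ := fun i => (Icc 1 N).filter (fun n => ∃ p s, p.Prime ∧ p ∣ n + i ∧
    s ∣ p + 1 ∧ s ∈ w.smoothNumbers ∧ z < s) with hS₂
  set S₃ := (Icc 1 N).filter (fun n => sigma 1 n = sigma 1 (n + 1) ∧ ∃ a b p q : ℕ, p.Prime ∧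
    q.Prime ∧ ¬ p ∣ a ∧ ¬ q ∣ b ∧ n = a * p ∧ n + 1 = b * q ∧ (a * b : ℝ) ≤ (N + 1) / V) with hS₃
  set S₄ := (Icc 1 N).filter (fun n => ∃ d p q : ℕ, V ^ 4 ≤ d ∧ d ∣ p + 1 ∧ d ∣ q + 1 ∧ p ∣ n ∧
    q ∣ n + 1 ∧ (p * q : ℝ) ≤ (N + 1) * V) with hS₄
  set S₅ : ℕ → ℕ → Finset ℕ := fun i j => (Icc 1 N).filter (fun n => ∃ d p b : ℕ, V ^ 4 ≤ d ∧
    (∀ r, r.Prime → r ∣ d → w ≤ r) ∧ d ∣ p + 1 ∧ d ∣ sigma 1 b ∧ p ∣ n + i ∧ b ∣ n + j ∧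
    p.Coprime b ∧ p * b ≤ N + 1) with hS₅
  have hcover : (Icc 1 N).filter (fun n => sigma 1 n = sigma 1 (n + 1)) ⊆
      ((S₀ 0 ∪ S₀ 1) ∪ (S₁ 0 ∪ S₁ 1)) ∪ ((S₂ 0 ∪ S₂ 1) ∪ (S₃ ∪ (S₄ ∪ (S₅ 0 1 ∪ S₅ 1 0)))) := by
    intro n hn
    by_contra hcon
    simp only [mem_union, not_or] at hcon
    obtain ⟨⟨⟨h00, h01⟩, h10, h11⟩, ⟨h20, h21⟩, h3, h4, h501, h510⟩ := hcon
    rw [mem_filter] at hn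
    obtain ⟨hnN, hs⟩ := hn
    have hn1 := (mem_Icc.1 hnN).1
    have hn2 := (mem_Icc.1 hnN).2
    simp only [hS₀, hS₁, hS₂, hS₃, hS₄, hS₅, mem_filter, hnN, true_and, not_exists, not_and, not_lt,
      add_zero, hs] at h00 h01 h10 h11 h20 h21 h3 h4 h501 h510
    rw [Nat.mem_smoothNumbers'] at h00 h01
    push Not at h00 h01
    obtain ⟨p, hp, ⟨a, ha⟩, hyp⟩ := h00
    obtain ⟨q, hq, ⟨b, hb⟩, hyq⟩ := h01
    have hpa : ¬ p ∣ a := fun hpa => h10 p hyp (by rw [ha, sq]; exact mul_dvd_mul_left p hpa)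
    have hqb : ¬ q ∣ b := fun hqb => h11 q hyq (by rw [hb, sq]; exact mul_dvd_mul_left q hqb)
    have hpn : p ∣ n := ⟨a, ha⟩
    have hqn : q ∣ n + 1 := ⟨b, hb⟩
    have han : a ∣ n := ⟨p, ha.trans (mul_comm _ _)⟩
    have hbn : b ∣ n + 1 := ⟨q, hb.trans (mul_comm _ _)⟩
    rw [mul_comm] at ha hb
    have hcop : n.Coprime (n + 1) :=
      (Nat.coprime_self_add_right (m := n)).2 (Nat.coprime_one_right n)
    have hpq : p ≠ q := by
      rintro rfl
      exact hp.one_lt.ne' (Nat.dvd_one.1 (hcop ▸ Nat.dvd_gcd hpn hqn))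
    have hsab : sigma 1 (a * p) = sigma 1 (b * q) := by rw [← ha, ← hb, hs]
    have hpqV : (p * q : ℝ) ≤ (N + 1) * V := by
      by_contra! hlt
      refine h3 a b p q hp hq hpa hqb ha hb ?_
      have hV0 : 0 < V := by linarith
      have hpq0 : (0 : ℝ) < p * q := lt_trans (by positivity) hlt
      have hab : ((a * b : ℝ)) * (p * q) ≤ (N + 1) * (N + 1) := by
        have h1 : (n : ℝ) = a * p := by exact_mod_cast ha
        have h2 : ((n : ℝ) + 1) = b * q := by exact_mod_cast hb
        have h3 : (n : ℝ) ≤ N := by exact_mod_cast hn2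
        calc ((a * b : ℝ)) * (p * q) = n * (n + 1) := by rw [h2, h1]; ring
          _ ≤ (N + 1) * (N + 1) := by gcongr; linarith
      rw [le_div_iff₀ hV0]
      refine le_of_mul_le_mul_right ?_ (by positivity : (0 : ℝ) < N + 1)
      calc (a * b * V * (N + 1) : ℝ) = a * b * ((N + 1) * V) := by ring
        _ ≤ a * b * (p * q) := by gcongr
        _ ≤ _ := hab
    rcases lt_or_gt_of_ne hpq with hlt | hlt
    · obtain ⟨d, hdV, hdw, hdp, hd⟩ := exists_rough_dvd hz hy hp hq hpa hqb hyp hsab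
        fun s hsp hsw => h20 p s hp hpn hsp hsw
      rcases hd with hd | hd
      · exact h4 d p q hdV hdp hd hpn hqn hpqV
      · refine h501 d p b hdV hdw hdp hd hpn hbn
          ((hcop.coprime_dvd_left hpn).coprime_dvd_right hbn) ?_
        calc p * b ≤ q * b := Nat.mul_le_mul_right b hlt.le
          _ = n + 1 := by rw [hb, mul_comm]
          _ ≤ N + 1 := by omega
    · obtain ⟨d, hdV, hdw, hdq, hd⟩ := exists_rough_dvd hz hy hq hp hqb hpa hyq hsab.symm
        fun s hsp hsw => h21 q s hq hqn hsp hsw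
      rcases hd with hd | hd
      · exact h4 d p q hdV hd hdq hpn hqn hpqV
      · refine h510 d q a hdV hdw hdq hd hqn han
          ((hcop.symm.coprime_dvd_left hqn).coprime_dvd_right han) ?_
        calc q * a ≤ p * a := Nat.mul_le_mul_right a hlt.le
          _ = n := by rw [ha, mul_comm]
          _ ≤ N + 1 := by omega
  have hcard := card_le_card hcover
  have hU : ∀ A B : Finset ℕ, (A ∪ B).card ≤ A.card + B.card := fun A B => card_union_le A B
  have hcard' : ((Icc 1 N).filter (fun n => sigma 1 n = sigma 1 (n + 1))).card ≤
      (S₀ 0).card + (S₀ 1).card + ((S₁ 0).card + (S₁ 1).card) + ((S₂ 0).card + (S₂ 1).card +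
        (S₃.card + (S₄.card + ((S₅ 0 1).card + (S₅ 1 0).card)))) := by
    have u1 := hU (S₀ 0) (S₀ 1)
    have u2 := hU (S₁ 0) (S₁ 1)
    have u3 := hU (S₂ 0) (S₂ 1)
    have u4 := hU (S₅ 0 1) (S₅ 1 0)
    have u5 := hU S₄ (S₅ 0 1 ∪ S₅ 1 0)
    have u6 := hU S₃ (S₄ ∪ (S₅ 0 1 ∪ S₅ 1 0))
    have u7 := hU (S₂ 0 ∪ S₂ 1) (S₃ ∪ (S₄ ∪ (S₅ 0 1 ∪ S₅ 1 0)))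
    have u8 := hU (S₀ 0 ∪ S₀ 1) (S₁ 0 ∪ S₁ 1)
    have u9 := hU ((S₀ 0 ∪ S₀ 1) ∪ (S₁ 0 ∪ S₁ 1))
      ((S₂ 0 ∪ S₂ 1) ∪ (S₃ ∪ (S₄ ∪ (S₅ 0 1 ∪ S₅ 1 0))))
    omega
  have hcardR : (((Icc 1 N).filter (fun n => sigma 1 n = sigma 1 (n + 1))).card : ℝ) ≤
      (S₀ 0).card + (S₀ 1).card + ((S₁ 0).card + (S₁ 1).card) + ((S₂ 0).card + (S₂ 1).card +
        (S₃.card + (S₄.card + ((S₅ 0 1).card + (S₅ 1 0).card)))) := by exact_mod_cast hcard'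
  have b00 := card_filter_add_smooth_le N y 0 zero_le_one hZ
  have b01 := card_filter_add_smooth_le N y 1 le_rfl hZ
  have b10 := card_filter_sq_dvd_le N y 0 zero_le_one hy0
  have b11 := card_filter_sq_dvd_le N y 1 le_rfl hy0
  have b20 := card_filter_smooth_dvd_succ_le N w 0 zero_le_one z
  have b21 := card_filter_smooth_dvd_succ_le N w 1 le_rfl z
  have b3 := card_filter_exists_cofactors_le h N (M := (N + 1) / V) (by positivity)
  have b4 := card_filter_dvd_succ_dvd_succ_le N hV
  have b501 := card_filter_dvd_succ_dvd_sigma_le N w 0 1 zero_le_one le_rfl hV hw hwκ hκ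
  have b510 := card_filter_dvd_succ_dvd_sigma_le N w 1 0 le_rfl zero_le_one hV hw hwκ hκ
  have e : 16 * (N + 1) * harmonicSum (N + 2) ^ 3 / V =
      8 * (N + 1) * harmonicSum (N + 2) ^ 3 / V +
        (4 * (N + 1) * harmonicSum (N + 2) ^ 3 / V + 4 * (N + 1) * harmonicSum (N + 2) ^ 3 / V) := by
    ring
  rw [e]
  linarith

theorem smoothTail_le_exp_sqrt_log (Y W : ℕ) {z δ : ℝ} (hz : 0 < z) (hδ : 0 < δ)
    (hδ' : δ ≤ 1 / 4) :
    smoothTail Y W z ≤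
      z ^ (-δ) * Real.exp (3 * (W : ℝ) ^ δ * √(2 * (1 + 2 * Real.log W))) := by
  refine (smoothTail_le Y W hz hδ hδ').trans ?_
  gcongr
  refine Real.le_sqrt_of_sq_le ((sum_inv_primesBelow_sq_le W).trans ?_)
  have := harmonicSum_le_one_add_log (W ^ 2)
  rw [Nat.cast_pow, Real.log_pow] at this
  push_cast at this
  linarith

theorem mul_one_add_inv_pow_sub_one_le {l H : ℝ} {E E' : ℕ} (hl : 240 ≤ l)
    (hH : H ≤ 3 * l) (hE : (E : ℝ) ≤ 4 * l) (hE' : (E' : ℝ) ≤ 4 * l) :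
    2 * H * (1 + E') * ((1 + (l ^ 4)⁻¹) ^ E - 1) ≤ 1 := by
  have hl0 : 0 < l := by linarith
  have h1 : (1 + (l ^ 4)⁻¹) ^ E ≤ Real.exp (4 / l ^ 3) := by
    calc (1 + (l ^ 4)⁻¹) ^ E ≤ Real.exp ((l ^ 4)⁻¹) ^ E := by
          refine pow_le_pow_left₀ (by positivity) ?_ _
          linarith [Real.add_one_le_exp ((l ^ 4)⁻¹)]
      _ = Real.exp (E * (l ^ 4)⁻¹) := (Real.exp_nat_mul _ _).symm
      _ ≤ Real.exp (4 * l * (l ^ 4)⁻¹) := by gcongr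
      _ = _ := by congr 1; field_simp
  have h2 : 4 / l ^ 3 ≤ 1 := by
    rw [div_le_one (by positivity)]
    nlinarith [le_self_pow₀ (by linarith : 1 ≤ l) (by norm_num : 3 ≠ 0)]
  have h3 : Real.exp (4 / l ^ 3) - 1 ≤ 8 / l ^ 3 := by
    have h4 : (0 : ℝ) ≤ 4 / l ^ 3 := by positivity
    have := Real.abs_exp_sub_one_le (x := 4 / l ^ 3) (by rwa [abs_of_nonneg h4])
    rw [abs_of_nonneg h4] at this
    calc _ ≤ _ := le_abs_self _
      _ ≤ _ := this
      _ = _ := by ring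
  have h5 : 0 ≤ (1 + (l ^ 4)⁻¹) ^ E - 1 := by
    linarith [one_le_pow₀ (by linarith [inv_nonneg.2 (by positivity : 0 ≤ l ^ 4)] :
      1 ≤ 1 + (l ^ 4)⁻¹) (n := E)]
  calc _ ≤ 2 * (3 * l) * (5 * l) * (8 / l ^ 3) := by
        gcongr
        · linarith
        · linarith
    _ = 240 / l := by field_simp; norm_num
    _ ≤ 1 := by rw [div_le_one hl0]; linarith

/-- The sum of the reciprocals of the `exp(529 μ)`-smooth numbers beyond `exp(l / 2)`. -/
theorem smoothTail_exp_le {l u μ : ℝ} {y : ℕ} (Y : ℕ) (hlu : l = u ^ 16) (hu : 4000 ≤ u)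
    (hlog : Real.log l ≤ u ^ 2) (hL0 : 0 < Real.log l)
    (hμL : 25392 * μ ^ 2 ≤ l * Real.log l) (huμ : u ^ 8 ≤ μ) (hμu : μ ≤ u ^ 9)
    (hy0 : (0 : ℝ) < y) (hyμ : (y : ℝ) ≤ Real.exp (529 * μ)) :
    smoothTail Y y (Real.exp (l / 2)) ≤ Real.exp (-(2 * μ)) := by
  have hu0 : 0 < u := by linarith
  have hl0 : 0 < l := by rw [hlu]; positivity
  have hμpos : 0 < μ := lt_of_lt_of_le (by positivity) huμ
  have hlogu : Real.exp (Real.log l / 8) = u ^ 2 := by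
    rw [hlu, Real.log_pow, ← Real.exp_log hu0, ← Real.exp_nat_mul, Real.log_exp]
    congr 1
    push_cast
    ring
  set δ := Real.log l / (4232 * μ) with hδ
  have hδ0 : 0 < δ := by positivity
  have hδ1 : δ ≤ 1 / 4 := by
    rw [hδ, div_le_iff₀ (by positivity)]
    have : u ^ 2 ≤ u ^ 8 := pow_le_pow_right₀ (by linarith) (by norm_num)
    linarith
  refine (smoothTail_le_exp_sqrt_log Y y (Real.exp_pos _) hδ0 hδ1).trans ?_
  have h1 : (y : ℝ) ^ δ ≤ u ^ 2 := by
    rw [← hlogu]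
    calc (y : ℝ) ^ δ ≤ Real.exp (529 * μ) ^ δ := Real.rpow_le_rpow hy0.le hyμ hδ0.le
      _ = Real.exp (Real.log l / 8) := by
        rw [← Real.exp_mul, hδ]
        congr 1
        field_simp
        norm_num
  have h2 : √(2 * (1 + 2 * Real.log y)) ≤ u ^ 5 := by
    rw [Real.sqrt_le_left (by positivity)]
    have h3 : Real.log y ≤ 529 * μ := by
      rw [Real.log_le_iff_le_exp hy0]
      exact hyμ
    have h4 : 4000 * u ^ 9 ≤ u ^ 10 := by
      rw [pow_succ u 9, mul_comm]
      gcongr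
    have h5 : 1 ≤ u ^ 9 := one_le_pow₀ (by linarith)
    calc _ ≤ u ^ 10 := by linarith
      _ = _ := by ring
  have h3 : 3 * u ^ 2 * u ^ 5 ≤ μ := by
    refine le_trans ?_ huμ
    have : 0 ≤ u ^ 7 := by positivity
    nlinarith
  have h4 : Real.exp (l / 2) ^ (-δ) ≤ Real.exp (-(3 * μ)) := by
    rw [← Real.exp_mul]
    gcongr
    have h5 : δ * μ = Real.log l / 4232 := by
      rw [hδ]
      field_simp
    have h6 : 3 * μ * μ ≤ l / 2 * δ * μ := by
      rw [mul_assoc (l / 2), h5]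
      linarith
    have := le_of_mul_le_mul_right h6 hμpos
    linarith
  calc _ ≤ Real.exp (-(3 * μ)) * Real.exp μ := by
        gcongr
        exact le_trans (by gcongr) h3
    _ = _ := by rw [← Real.exp_add]; ring_nf

/-- The sum of the reciprocals of the `l ^ 16`-smooth numbers beyond `exp(512 μ)`. -/
theorem smoothTail_pow_le {l u μ : ℝ} {w : ℕ} (Y : ℕ) (hlu : l = u ^ 16) (hu : 4000 ≤ u)
    (hlog : Real.log l ≤ u ^ 2) (huμ : u ^ 8 ≤ μ) (hw0 : 0 < w) (hwl : (w : ℝ) ≤ 2 * l ^ 16) :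
    smoothTail Y w (Real.exp (512 * μ)) ≤ Real.exp (-(3 * μ)) := by
  have hu0 : 0 < u := by linarith
  have hl0 : 0 < l := by rw [hlu]; positivity
  have hμpos : 0 < μ := lt_of_lt_of_le (by positivity) huμ
  refine (smoothTail_le_exp_sqrt_log Y w (Real.exp_pos _) (δ := 1 / 128) (by norm_num)
    (by norm_num)).trans ?_
  have hw0' : (0 : ℝ) < w := by exact_mod_cast hw0
  have h1 : (w : ℝ) ^ (1 / 128 : ℝ) ≤ 2 * u ^ 2 := by
    calc (w : ℝ) ^ (1 / 128 : ℝ) ≤ (2 * l ^ 16) ^ (1 / 128 : ℝ) :=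
          Real.rpow_le_rpow hw0'.le hwl (by norm_num)
      _ = 2 ^ (1 / 128 : ℝ) * u ^ 2 := by
        rw [Real.mul_rpow (by norm_num) (by positivity)]
        congr 1
        rw [hlu, ← pow_mul, ← Real.rpow_natCast, ← Real.rpow_mul hu0.le, ← Real.rpow_natCast]
        norm_num
      _ ≤ 2 * u ^ 2 := by
        gcongr
        calc (2 : ℝ) ^ (1 / 128 : ℝ) ≤ 2 ^ (1 : ℝ) :=
              Real.rpow_le_rpow_of_exponent_le (by norm_num) (by norm_num)
          _ = 2 := Real.rpow_one 2
  have h2 : √(2 * (1 + 2 * Real.log w)) ≤ u ^ 4 := by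
    rw [Real.sqrt_le_left (by positivity)]
    have h3 : Real.log w ≤ 1 + 16 * u ^ 2 := by
      have h4 := Real.log_le_log hw0' hwl
      rw [Real.log_mul (by norm_num) (by positivity), Real.log_pow] at h4
      push_cast at h4
      linarith [Real.log_two_lt_d9]
    have h5 : 1 ≤ u ^ 2 := one_le_pow₀ (by linarith)
    have h6 : 4000 ≤ u ^ 6 := hu.trans (le_self_pow₀ (by linarith) (by norm_num))
    calc _ ≤ 4000 * u ^ 2 := by linarith
      _ ≤ u ^ 6 * u ^ 2 := by gcongr
      _ = _ := by ring
  have h3 : 3 * (2 * u ^ 2) * u ^ 4 ≤ μ := by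
    refine le_trans ?_ huμ
    have h4 : 6 ≤ u ^ 2 := by nlinarith
    calc _ = 6 * u ^ 6 := by ring
      _ ≤ u ^ 2 * u ^ 6 := by gcongr
      _ = _ := by ring
  calc _ ≤ Real.exp (-(4 * μ)) * Real.exp μ := by
        rw [← Real.exp_mul]
        gcongr
        · linarith
        · exact le_trans (by gcongr) h3
    _ = _ := by rw [← Real.exp_add]; ring_nf

/-- The bound for large `x`; here `u = (log x) ^ (1 / 16)`. -/
theorem card_filter_sigma_eq_le_of_large
    (h : ¬ ∃ m : ℕ, 1 ≤ m ∧ m ∣ sigma 1 m ∧ (m + 1) ∣ sigma 1 (m + 1))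
    {x l u μ : ℝ} (hx : x = Real.exp l) (hlu : l = u ^ 16) (hu : 4000 ≤ u)
    (hlog : Real.log l ≤ u ^ 2) (hll : 2 ≤ Real.log (Real.log l))
    (hll' : 12696 * Real.log (Real.log l) ≤ Real.log l) (hexp : 912 * l ^ 3 ≤ Real.exp (u ^ 8))
    (hμ : μ = √(l * Real.log (Real.log l) / 2)) :
    (((Icc 1 ⌊x⌋₊).filter (fun n => sigma 1 n = sigma 1 (n + 1))).card : ℝ) ≤
      x * Real.exp (-μ) := by
  have hu0 : 0 < u := by linarith
  have hul : u ≤ l := by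
    rw [hlu]
    exact le_self_pow₀ (by linarith) (by norm_num)
  have hl : 4000 ≤ l := hu.trans hul
  have hl0 : 0 < l := by linarith
  have hL0 : 0 < Real.log l := by linarith
  have hμsq : μ ^ 2 = l * Real.log (Real.log l) / 2 := by
    rw [hμ, Real.sq_sqrt (by positivity)]
  have hμ0 : 0 ≤ μ := by rw [hμ]; positivity
  have huμ : u ^ 8 ≤ μ := by
    refine le_of_pow_le_pow_left₀ two_ne_zero hμ0 ?_
    rw [hμsq, ← pow_mul, ← hlu]
    nlinarith
  have hμu : μ ≤ u ^ 9 := by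
    refine le_of_pow_le_pow_left₀ two_ne_zero (by positivity) ?_
    have h1 : Real.log (Real.log l) ≤ u ^ 2 := by linarith
    calc μ ^ 2 = u ^ 16 * Real.log (Real.log l) / 2 := by rw [hμsq, hlu]
      _ ≤ u ^ 16 * u ^ 2 := by
        have := mul_le_mul_of_nonneg_left h1 (by positivity : 0 ≤ u ^ 16)
        have h2 : 0 ≤ u ^ 16 * Real.log (Real.log l) := by positivity
        linarith
      _ = _ := by ring
  have hμpos : 0 < μ := lt_of_lt_of_le (by positivity) huμ
  set N := ⌊x⌋₊ with hN
  have hx0 : 0 < x := hx ▸ Real.exp_pos l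
  have hx1 : 4 ≤ x := by rw [hx]; linarith [Real.add_one_le_exp l]
  have hNx : (N : ℝ) ≤ x := Nat.floor_le hx0.le
  have hlogN : Real.log ((N + 2 : ℕ) : ℝ) ≤ 2 * l := by
    rw [Real.log_le_iff_le_exp (by positivity), two_mul, Real.exp_add, ← hx]
    push_cast
    nlinarith
  have hH2 : harmonicSum (N + 2) ≤ 3 * l := by
    linarith [harmonicSum_le_one_add_log (N + 2)]
  have hH1 : harmonicSum (N + 1) ≤ 3 * l := (harmonicSum_mono (by omega)).trans hH2
  have hH2' : 0 ≤ harmonicSum (N + 2) := zero_le_one.trans (one_le_harmonicSum (by omega))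
  have hH1' : 0 ≤ harmonicSum (N + 1) := zero_le_one.trans (one_le_harmonicSum (by omega))
  have hE : ((Nat.log 2 (N + 2) : ℕ) : ℝ) ≤ 4 * l := by
    have h1 : ((2 ^ Nat.log 2 (N + 2) : ℕ) : ℝ) ≤ ((N + 2 : ℕ) : ℝ) := by
      exact_mod_cast Nat.pow_log_le_self 2 (by omega)
    have h2 := Real.log_le_log (by positivity) h1
    rw [Nat.cast_pow, Real.log_pow] at h2
    have h3 := Real.log_two_gt_d9
    push_cast at h2 hlogN
    have h4 : (0 : ℝ) ≤ (Nat.log 2 (N + 2) : ℕ) := Nat.cast_nonneg _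
    nlinarith
  have hE1 : ((Nat.log 2 (N + 1) : ℕ) : ℝ) ≤ 4 * l :=
    le_trans (by exact_mod_cast Nat.log_mono_right (by omega)) hE
  set w := ⌈l ^ 16⌉₊ with hw
  have hlw : l ^ 16 ≤ w := Nat.le_ceil _
  have hl16 : 1 ≤ l ^ 16 := one_le_pow₀ (by linarith)
  have hwl : (w : ℝ) ≤ 2 * l ^ 16 := by
    have := Nat.ceil_lt_add_one (by positivity : 0 ≤ l ^ 16)
    linarith
  have hw0 : 0 < w := Nat.ceil_pos.2 (by positivity)
  set y := ⌈Real.exp (528 * μ)⌉₊ with hy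
  have hμy : Real.exp (528 * μ) ≤ y := Nat.le_ceil _
  have hyμ : (y : ℝ) ≤ Real.exp (529 * μ) := by
    have h1 := Nat.ceil_lt_add_one (Real.exp_pos (528 * μ)).le
    have h2 : 1 ≤ Real.exp (528 * μ) := Real.one_le_exp (by positivity)
    have h3 : 2 ≤ Real.exp μ := by
      have : 1 ≤ u ^ 8 := one_le_pow₀ (by linarith)
      linarith [Real.add_one_le_exp μ]
    have h4 : Real.exp (529 * μ) = Real.exp (528 * μ) * Real.exp μ := by
      rw [← Real.exp_add]; ring_nf
    nlinarith
  have hy0 : (0 : ℝ) < y := lt_of_lt_of_le (Real.exp_pos _) hμy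
  have hwκ : (w : ℝ) ^ (-(1 / 4) : ℝ) ≤ (l ^ 4)⁻¹ := by
    calc (w : ℝ) ^ (-(1 / 4) : ℝ) ≤ (l ^ 16) ^ (-(1 / 4) : ℝ) :=
          Real.rpow_le_rpow_of_nonpos (by positivity) hlw (by norm_num)
      _ = (l ^ 4)⁻¹ := by
        rw [← Real.rpow_natCast, ← Real.rpow_mul hl0.le, ← Real.rpow_natCast,
          ← Real.rpow_neg hl0.le]
        norm_num
  have hyV : Real.exp (512 * μ) * Real.exp (2 * μ) ^ 8 ≤ y := by
    refine le_of_eq_of_le ?_ hμy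
    rw [← Real.exp_nat_mul, ← Real.exp_add]
    congr 1
    push_cast
    ring
  have hκ := mul_one_add_inv_pow_sub_one_le (by linarith) hH2 hE hE1
  have hTy := smoothTail_exp_le (N + 1) hlu hu hlog hL0
    (by rw [hμsq]; linarith [mul_le_mul_of_nonneg_left hll' hl0.le]) huμ hμu hy0 hyμ
  have hTw := smoothTail_pow_le (N + 2) hlu hu hlog huμ hw0 hwl
  have hZ : Real.exp (l / 2) ≤ x * Real.exp (-(2 * μ)) := by
    rw [hx, ← Real.exp_add]
    gcongr
    have : 4 * u ^ 9 ≤ u ^ 16 := by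
      have h4 : 4 ≤ u ^ 7 := le_trans (by linarith) (le_self_pow₀ (by linarith) (by norm_num : 7 ≠ 0))
      calc _ ≤ u ^ 7 * u ^ 9 := by gcongr
        _ = _ := by ring
    linarith
  have key := card_filter_sigma_eq_le h N y w (V := Real.exp (2 * μ)) (Z := Real.exp (l / 2))
    (z := Real.exp (512 * μ)) (κ := (l ^ 4)⁻¹) (Real.one_le_exp (by positivity))
    (Real.exp_pos _).le (Real.exp_pos _) hw0 hyV hwκ hκ
  set W := Real.exp (-(2 * μ)) with hW
  have hW0 : 0 < W := Real.exp_pos _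
  have hN1 : (N : ℝ) + 1 ≤ 2 * x := by linarith
  have hVW : ∀ a : ℝ, a / Real.exp (2 * μ) = a * W := fun a => by
    rw [hW, Real.exp_neg, div_eq_mul_inv]
  have hyW : ∀ a : ℝ, 0 ≤ a → a / y ≤ a * W := fun a ha => by
    rw [← hVW]
    refine div_le_div_of_nonneg_left ha (Real.exp_pos _) (le_trans ?_ hμy)
    gcongr
    norm_num
  have hTw' : smoothTail (N + 2) w (Real.exp (512 * μ)) ≤ W := by
    refine hTw.trans ?_
    rw [hW]
    gcongr
    norm_num
  have hl3 : l ≤ l ^ 3 := le_self_pow₀ (by linarith) (by norm_num)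
  have hl31 : 1 ≤ l ^ 3 := one_le_pow₀ (by linarith)
  have t1 : (N + 1) * smoothTail (N + 1) y (Real.exp (l / 2)) ≤ 2 * x * W := by
    have := smoothTail_nonneg (N + 1) y (Real.exp (l / 2))
    gcongr
  have t2 : (N + 1) * harmonicSum (N + 1) / y ≤ 2 * x * (3 * l) * W := by
    refine (hyW _ (by positivity)).trans ?_
    gcongr
  have t3 : 2 * (N + 1) * harmonicSum (N + 2) * smoothTail (N + 2) w (Real.exp (512 * μ)) ≤
      2 * (2 * x) * (3 * l) * W := by
    have := smoothTail_nonneg (N + 2) w (Real.exp (512 * μ))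
    gcongr
  have t4 : (N + 1) / Real.exp (2 * μ) * harmonicSum (N + 1) ≤ 2 * x * W * (3 * l) := by
    rw [hVW]
    gcongr
  have t5 : 16 * (N + 1) * harmonicSum (N + 2) ^ 3 / Real.exp (2 * μ) ≤
      16 * (2 * x) * (3 * l) ^ 3 * W := by
    rw [hVW]
    gcongr
  have hxW : 0 < x * W := by positivity
  calc _ ≤ 2 * (x * W + 2 * x * W) + 2 * (2 * x * (3 * l) * W) +
        2 * (2 * (2 * x) * (3 * l) * W) + 2 * x * W * (3 * l) + 16 * (2 * x) * (3 * l) ^ 3 * W := by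
        refine le_trans ?_ (key.trans ?_)
        · exact le_of_eq (by congr!)
        · linarith
    _ = x * W * (6 + 42 * l + 864 * l ^ 3) := by ring
    _ ≤ x * W * (912 * l ^ 3) := by
        gcongr
        linarith
    _ ≤ x * W * Real.exp μ := by
        gcongr
        exact hexp.trans (by gcongr)
    _ = x * Real.exp (-μ) := by
        rw [hW, mul_assoc, ← Real.exp_add]
        ring_nf

open Filter in
theorem eventually_log_bounds : ∀ᶠ l : ℝ in atTop, 4000 ≤ l ^ (1 / 16 : ℝ) ∧
    Real.log l ≤ (l ^ (1 / 16 : ℝ)) ^ 2 ∧ 2 ≤ Real.log (Real.log l) ∧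
    12696 * Real.log (Real.log l) ≤ Real.log l ∧
    912 * l ^ 3 ≤ Real.exp ((l ^ (1 / 16 : ℝ)) ^ 8) := by
  have hu : Tendsto (fun l : ℝ => l ^ (1 / 16 : ℝ)) atTop atTop :=
    tendsto_rpow_atTop (by norm_num)
  have hll : Tendsto (fun l : ℝ => Real.log (Real.log l)) atTop atTop :=
    Real.tendsto_log_atTop.comp Real.tendsto_log_atTop
  have h2 := (isLittleO_log_rpow_atTop (show (0 : ℝ) < 1 / 8 by norm_num)).bound one_pos
  have h4 := (Real.isLittleO_log_id_atTop.comp_tendsto Real.tendsto_log_atTop).bound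
    (show (0 : ℝ) < 1 / 12696 by norm_num)
  have h5 := ((Real.tendsto_pow_mul_exp_neg_atTop_nhds_zero 6).comp
    ((tendsto_pow_atTop (α := ℝ) (n := 8) (by norm_num)).comp hu)).eventually_le_const
    (show (0 : ℝ) < 1 / 912 by norm_num)
  filter_upwards [hu.eventually_ge_atTop 4000, h2, hll.eventually_ge_atTop 2, h4, h5,
    eventually_ge_atTop 1] with l h1 h2 h3 h4 h5 hl
  have hlog : 0 ≤ Real.log l := Real.log_nonneg hl
  refine ⟨h1, ?_, h3, ?_, ?_⟩
  · rw [one_mul, Real.norm_of_nonneg hlog, Real.norm_of_nonneg (by positivity)] at h2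
    refine h2.trans_eq ?_
    rw [← Real.rpow_natCast, ← Real.rpow_mul (by linarith)]
    norm_num
  · simp only [Function.comp_apply, id_eq] at h4
    rw [Real.norm_of_nonneg (by linarith), Real.norm_of_nonneg hlog] at h4
    linarith
  · simp only [Function.comp_apply] at h5
    have h6 : ((l ^ (1 / 16 : ℝ)) ^ 8) ^ 6 = l ^ 3 := by
      rw [← pow_mul, ← Real.rpow_natCast, ← Real.rpow_mul (by linarith), ← Real.rpow_natCast]
      norm_num
    rw [h6, Real.exp_neg, ← div_eq_mul_inv, div_le_iff₀ (Real.exp_pos _)] at h5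
    linarith

theorem corollary1p4
    (h : ¬ ∃ m : ℕ, 1 ≤ m ∧ m ∣ ArithmeticFunction.sigma 1 m ∧
      (m + 1) ∣ ArithmeticFunction.sigma 1 (m + 1)) :
    ∃ C : ℝ, 0 < C ∧ ∀ x : ℝ, Real.exp (Real.exp 1) ≤ x →
      (((Finset.Icc 1 ⌊x⌋₊).filter (fun n : ℕ =>
          ArithmeticFunction.sigma 1 n = ArithmeticFunction.sigma 1 (n + 1))).card : ℝ) ≤
        C * (x * Real.exp (-((2 : ℝ) ^ (-(1 / 2) : ℝ) *
          (Real.log x * Real.log (Real.log (Real.log x))) ^ (1 / 2 : ℝ)))) := by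
  obtain ⟨M, hM⟩ := Filter.eventually_atTop.1 eventually_log_bounds
  set K := (2 : ℝ) ^ (-(1 / 2) : ℝ) * (M * Real.log (Real.log M)) ^ (1 / 2 : ℝ) with hK
  refine ⟨max 1 (Real.exp K), by positivity, fun x hx => ?_⟩
  have hx0 : 0 < x := (Real.exp_pos _).trans_le hx
  have hl : Real.exp 1 ≤ Real.log x := (Real.le_log_iff_exp_le hx0).2 hx
  have hl0 : 0 < Real.log x := (Real.exp_pos 1).trans_le hl
  have hll : 1 ≤ Real.log (Real.log x) := (Real.le_log_iff_exp_le hl0).2 hl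
  have hlll : 0 ≤ Real.log (Real.log (Real.log x)) := Real.log_nonneg hll
  rcases le_total M (Real.log x) with hMx | hMx
  · obtain ⟨h1, h2, h3, h4, h5⟩ := hM _ hMx
    have hpow : Real.log x = (Real.log x ^ (1 / 16 : ℝ)) ^ 16 := by
      rw [← Real.rpow_natCast, ← Real.rpow_mul hl0.le]
      norm_num
    have key := card_filter_sigma_eq_le_of_large h (Real.exp_log hx0).symm hpow h1 h2 h3 h4 h5 rfl
    have hμ : √(Real.log x * Real.log (Real.log (Real.log x)) / 2) = (2 : ℝ) ^ (-(1 / 2) : ℝ) *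
        (Real.log x * Real.log (Real.log (Real.log x))) ^ (1 / 2 : ℝ) := by
      rw [Real.sqrt_eq_rpow, div_eq_inv_mul, Real.mul_rpow (by norm_num) (by positivity),
        Real.inv_rpow (by norm_num), Real.rpow_neg (by norm_num)]
    rw [hμ] at key
    refine key.trans ?_
    exact le_mul_of_one_le_left (by positivity) (le_max_left _ _)
  · have hcard : (((Finset.Icc 1 ⌊x⌋₊).filter (fun n : ℕ =>
        ArithmeticFunction.sigma 1 n = ArithmeticFunction.sigma 1 (n + 1))).card : ℝ) ≤ x := by
      refine le_trans ?_ (Nat.floor_le hx0.le)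
      have := card_filter_le (Icc 1 ⌊x⌋₊) (fun n : ℕ => sigma 1 n = sigma 1 (n + 1))
      rw [Nat.card_Icc, Nat.add_sub_cancel] at this
      exact_mod_cast this
    have hle : (2 : ℝ) ^ (-(1 / 2) : ℝ) *
        (Real.log x * Real.log (Real.log (Real.log x))) ^ (1 / 2 : ℝ) ≤ K := by
      have hM0 : 0 ≤ M := hl0.le.trans hMx
      rw [hK]
      gcongr
    calc _ ≤ x := hcard
      _ = Real.exp K * (x * Real.exp (-K)) := by
        rw [Real.exp_neg]
        field_simp
      _ ≤ _ := by
        gcongr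
        exact le_max_right _ _
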